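/- Let $n \ge 1$, let $P_{Y} = \mathcal N(0, I_n)$ be the standard Gaussian measure on $\mathbb R^n$, and let $P_Z$ be a Borel probability measure on $\mathbb R^n$ with $P_Z \ll P_Y$ and $\mathbb E\|Z\|^2 < \infty$ for $Z \sim P_Z$. Let $$W_2(P_Z,P_Y) = \inf_{P} \big(\mathbb E_P \|Z - Y\|_2^2\big)^{1/2},$$ where the infimum is over all couplings $P$ of $P_Z$ and $P_Y$, let $h(Z) = -\int f_Z \ln f_Z \in [-\infty, \infty)$ be the differential entropy of $Z$, where $f_Z$ is the density of $P_Z$, and let $D(P_Z\|P_Y) \in [0,\infty]$ be the Kullback–Leibler divergence with natural logarithms. Put $e^{-\infty} = 0$ and $$B(P_Z) = \mathbb E\|Z\|^2 + n - 2n\sqrt{\tfrac{1}{2\pi e}\, e^{\frac{2}{n} h(Z)}}.$$ Then $$W_2^2(P_Z, P_Y) \le B(P_Z),$$ and equality holds whenever $P_Z$ is an isotropic Gaussian, that is, $P_Z = \mathcal N(\mu, \sigma^2 I_n)$ for some $\mu \in \mathbb R^n$ and $\sigma > 0$. Moreover, this bound is never weaker than Talagrand's bound: $$B(P_Z) \le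 2 D(P_Z \| P_Y),$$ with equality if and only if $h(Z) = \frac n2 \ln (2\pi e)$, which is the case when $P_Z = \mathcal N(\mu, I_n)$ for some $\mu \in \mathbb R^n$. -/

import Mathlib

open MeasureTheory ProbabilityTheory InformationTheory
open scoped ENNReal

noncomputable section

/-- The couplings of `μ` and `ν`: probability measures on the product space with marginals
`μ` and `ν`. -/
def couplings {Ω : Type*} [MeasurableSpace Ω] (μ ν : Measure Ω) : Set (Measure (Ω × Ω)) :=
  {π | IsProbabilityMeasure π ∧ π.fst = μ ∧ π.snd = ν}

/-- The Wasserstein distance of order `p`: the infimum over all couplings `π` of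
`(E_π [d(Z, Y) ^ p]) ^ (1 / p)`, with values in `[0, ∞]`. -/
def wassersteinDist {Ω : Type*} [MeasurableSpace Ω] [PseudoEMetricSpace Ω] (p : ℝ)
    (μ ν : Measure Ω) : ℝ≥0∞ :=
  ⨅ π ∈ couplings μ ν, (∫⁻ x, edist x.1 x.2 ^ p ∂π) ^ (1 / p)

/-- The density of `μ` with respect to the reference (Lebesgue) measure. -/
def lebesgueDensity {E : Type*} [MeasureSpace E] (μ : Measure E) (x : E) : ℝ :=
  (μ.rnDeriv volume x).toReal

/-- The differential entropy `h(μ) = - ∫ f log f` (natural logarithm) of a measure `μ` with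
density `f`. It is extended-real valued: the integral of the positive part of `- f log f` minus the
integral of its negative part. A probability measure on `ℝⁿ` with a density and a finite second
moment has a finite positive part, so that the difference is then well defined and `h(μ) < ∞`,
while `h(μ) = -∞` is possible. -/
def differentialEntropy {E : Type*} [MeasureSpace E] (μ : Measure E) : EReal :=
  ((∫⁻ x, ENNReal.ofReal (Real.negMulLog (lebesgueDensity μ x)) : ℝ≥0∞) : EReal) -
    ((∫⁻ x, ENNReal.ofReal (-Real.negMulLog (lebesgueDensity μ x)) : ℝ≥0∞) : EReal)

/-- The second moment `E ‖Z‖²` of a random vector `Z` with law `μ`. -/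
def secondMoment {E : Type*} [MeasurableSpace E] [NormedAddCommGroup E] (μ : Measure E) : ℝ≥0∞ :=
  ∫⁻ x, ‖x‖ₑ ^ 2 ∂μ

/-- The quantity `E ‖Z‖² + n - 2 n √((1 / (2 π e)) exp ((2 / n) h(Z)))` for a random vector `Z` in
`ℝⁿ` with law `μ`. Here `exp (-∞) = 0` and `√` is the power `1 / 2` in `[0, ∞]`. -/
def transportBound {n : ℕ} (μ : Measure (EuclideanSpace ℝ (Fin n))) : EReal :=
  (secondMoment μ : EReal) + ((n : ℝ) : EReal) -
    ((2 * n : ℝ) : EReal) *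
      (((ENNReal.ofReal (1 / (2 * Real.pi * Real.exp 1)) *
        EReal.exp (((2 / n : ℝ) : EReal) * differentialEntropy μ)) ^ (1 / 2 : ℝ) : ℝ≥0∞) : EReal)

end

section

open Filter Set Topology

/-! The core is Talagrand's inequality `W₂² ≤ 2 D`, applied not to `Z` but to a dilation `aZ`. On
the line, let `T` be the monotone map pushing the standard Gaussian `γ` to `ν`. Taking logarithms in
the Monge–Ampère equation writes the log-likelihood ratio at `T y` as `T²/2 - y²/2 - log T'`. Then
`log T' ≤ T' - 1`, together with Gaussian integration by parts `∫ T' dγ ≤ ∫ y T dγ`, gives `∫ (T -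
y)² dγ ≤ 2 D` (`lintegral_gaussianTransport_sub_sq_le`). The chain rule for relative entropy
tensorizes this: each new coordinate is moved by the monotone map of its conditional law
(`exists_coupling_prod_gaussianReal`).

For `a > 0`, a good coupling of `aZ` with `Y` becomes one of `Z` with `Y` after dividing by `a`, and
the cross term `⟨Z, Y⟩` is recovered by polarization. This gives `W₂² ≤ E‖Z‖² + n + (-2 h(Z) - 2n
log a + n log 2π - n) / a` (`exists_coupling_of_scaling`). The minimizing `a` is the one for which
`aZ` has the entropy of a standard Gaussian, and its value is `B`. If `h(Z) = -∞`, then `B = E‖Z‖² +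
n` is the cost of the independent coupling.

With `t = h(Z)/n - log(2πe)/2`, the comparison `B ≤ 2 D` is `1 + t ≤ exp t`, which is an equality
only at `t = 0`. For an isotropic Gaussian, a completed square bounds the cost of every coupling
from below by `B`. -/

/-! ### Monotone transport from the Gaussian on the line -/

theorem continuous_cdf (ν : Measure ℝ) [IsProbabilityMeasure ν] [NullSingletonClass ν] :
    Continuous (cdf ν) := by
  refine continuous_iff_continuousAt.2 fun x => ?_
  rw [(monotone_cdf ν).continuousAt_iff_leftLim_eq_rightLim, StieltjesFunction.rightLim_eq]
  have h := (cdf ν).measure_singleton x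
  rw [measure_cdf, measure_singleton] at h
  have h1 := ENNReal.ofReal_eq_zero.1 h.symm
  have h2 := (monotone_cdf ν).leftLim_le (le_refl x)
  linarith

instance : NullSingletonClass (gaussianReal 0 1) := nullSingletonClass_gaussianReal one_ne_zero

instance : (gaussianReal 0 1).IsOpenPosMeasure :=
  (gaussianReal_absolutelyContinuous' 0 one_ne_zero).isOpenPosMeasure

theorem strictMono_cdf (ν : Measure ℝ) [IsProbabilityMeasure ν] [ν.IsOpenPosMeasure] :
    StrictMono (cdf ν) := by
  intro a b hab
  have h := (cdf ν).measure_Ioc a b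
  rw [measure_cdf] at h
  have h1 : 0 < ν (Ioc a b) :=
    (isOpen_Ioo.measure_pos ν (nonempty_Ioo.2 hab)).trans_le (measure_mono Ioo_subset_Ioc_self)
  rw [h, ENNReal.ofReal_pos] at h1
  linarith

theorem cdf_pos (ν : Measure ℝ) [IsProbabilityMeasure ν] [ν.IsOpenPosMeasure] (x : ℝ) :
    0 < cdf ν x :=
  (cdf_nonneg ν (x - 1)).trans_lt (strictMono_cdf ν (by linarith))

theorem cdf_lt_one (ν : Measure ℝ) [IsProbabilityMeasure ν] [ν.IsOpenPosMeasure] (x : ℝ) :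
    cdf ν x < 1 :=
  (strictMono_cdf ν (by linarith : x < x + 1)).trans_le (cdf_le_one ν _)

/-- The monotone transport map from the standard Gaussian measure on `ℝ` to `ν`. -/
noncomputable def gaussianTransport (ν : Measure ℝ) (y : ℝ) : ℝ :=
  sInf {x | cdf (gaussianReal 0 1) y ≤ cdf ν x}

/-- Right-continuity of the distribution function makes the infimum attained, so the transport map
is a generalized inverse with a Galois-type adjunction. Since the Gaussian distribution function
takes values strictly between 0 and 1, the set is nonempty and bounded below, so the default value
of `sInf` never enters. -/
theorem gaussianTransport_le_iff (ν : Measure ℝ) (x y : ℝ) :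
    gaussianTransport ν y ≤ x ↔ cdf (gaussianReal 0 1) y ≤ cdf ν x := by
  set c := cdf (gaussianReal 0 1) y
  have hne : {x | c ≤ cdf ν x}.Nonempty :=
    ((tendsto_cdf_atTop ν).eventually (lt_mem_nhds (cdf_lt_one (gaussianReal 0 1) y))).exists.imp
      fun _ h => le_of_lt h
  have hbdd : BddBelow {x | c ≤ cdf ν x} := by
    obtain ⟨b, hb⟩ := ((tendsto_cdf_atBot ν).eventually
      (gt_mem_nhds (cdf_pos (gaussianReal 0 1) y))).exists
    refine ⟨b, fun x hx => le_of_not_gt fun hlt => ?_⟩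
    exact absurd (hx.trans (monotone_cdf ν hlt.le)) (not_le.2 hb)
  refine ⟨fun h => ?_, fun h => csInf_le hbdd h⟩
  refine le_trans ?_ (monotone_cdf ν h)
  have hr : Tendsto (cdf ν) (𝓝[>] (gaussianTransport ν y)) (𝓝 (cdf ν (gaussianTransport ν y))) :=
    ((cdf ν).right_continuous _).mono_left (nhdsWithin_mono _ Ioi_subset_Ici_self)
  refine ge_of_tendsto hr (eventually_nhdsWithin_of_forall fun z hz => ?_)
  obtain ⟨w, hw, hwz⟩ := exists_lt_of_csInf_lt hne hz
  exact le_trans hw (monotone_cdf ν hwz.le)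

theorem monotone_gaussianTransport (ν : Measure ℝ) : Monotone (gaussianTransport ν) := by
  intro a b hab
  rw [gaussianTransport_le_iff]
  exact (monotone_cdf _ hab).trans ((gaussianTransport_le_iff ν _ b).1 le_rfl)

/-- The probability integral transform: a continuous distribution function sends its own law to the
uniform law on the unit interval. -/
theorem gaussianReal_cdf_le {u : ℝ} (h0 : 0 ≤ u) (h1 : u ≤ 1) :
    gaussianReal 0 1 {y | cdf (gaussianReal 0 1) y ≤ u} = ENNReal.ofReal u := by
  rcases h0.eq_or_lt with rfl | h0
  · have : {y | cdf (gaussianReal 0 1) y ≤ 0} = ∅ :=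
      eq_empty_of_forall_notMem fun y hy => absurd hy (not_le.2 (cdf_pos _ y))
    simp [this]
  rcases h1.eq_or_lt with rfl | h1
  · have : {y | cdf (gaussianReal 0 1) y ≤ 1} = univ := eq_univ_of_forall fun y => cdf_le_one _ y
    simp [this]
  obtain ⟨a, ha⟩ := ((tendsto_cdf_atBot (gaussianReal 0 1)).eventually (gt_mem_nhds h0)).exists
  obtain ⟨b, hb⟩ := ((tendsto_cdf_atTop (gaussianReal 0 1)).eventually (lt_mem_nhds h1)).exists
  obtain ⟨c, rfl⟩ := mem_range_of_exists_le_of_exists_ge (continuous_cdf (gaussianReal 0 1))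
    ⟨a, ha.le⟩ ⟨b, hb.le⟩
  have : {y | cdf (gaussianReal 0 1) y ≤ cdf (gaussianReal 0 1) c} = Iic c := by
    ext y; exact (strictMono_cdf _).le_iff_le
  rw [this, ofReal_cdf]

theorem map_gaussianTransport (ν : Measure ℝ) [IsProbabilityMeasure ν] :
    (gaussianReal 0 1).map (gaussianTransport ν) = ν := by
  have hm := (monotone_gaussianTransport ν).measurable
  have : IsProbabilityMeasure ((gaussianReal 0 1).map (gaussianTransport ν)) :=
    Measure.isProbabilityMeasure_map hm.aemeasurable
  refine Measure.ext_of_Iic _ _ fun x => ?_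
  rw [Measure.map_apply hm measurableSet_Iic, ← ofReal_cdf ν,
    ← gaussianReal_cdf_le (cdf_nonneg ν x) (cdf_le_one ν x)]
  congr 1
  ext y
  exact gaussianTransport_le_iff ν x y

/-- Without atoms the distribution function of `ν` is continuous and cannot jump past the target
level. This is the integrated form of the Monge–Ampère equation. -/
theorem cdf_gaussianTransport (ν : Measure ℝ) [IsProbabilityMeasure ν] [NullSingletonClass ν]
    (y : ℝ) : cdf ν (gaussianTransport ν y) = cdf (gaussianReal 0 1) y := by
  refine le_antisymm (le_of_not_gt fun hlt => ?_) ((gaussianTransport_le_iff ν _ y).1 le_rfl)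
  have h := ((continuous_cdf ν).tendsto (gaussianTransport ν y)).mono_left
    (nhdsWithin_le_nhds (s := Iio (gaussianTransport ν y)))
  obtain ⟨x, hx, hx'⟩ := ((h.eventually (lt_mem_nhds hlt)).and self_mem_nhdsWithin).exists
  exact absurd ((gaussianTransport_le_iff ν x y).2 hx.le) (not_le.2 hx')

/-- Joint measurability in the parameter lets the conditional transports be assembled into a single
coupling; the adjunction reduces it to measurability of `κ p.1 (Iic x)`. -/
theorem measurable_gaussianTransport_kernel {α : Type*} [MeasurableSpace α] (κ : Kernel α ℝ)
    [IsMarkovKernel κ] : Measurable fun p : α × ℝ => gaussianTransport (κ p.1) p.2 := by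
  refine measurable_of_Iic fun x => ?_
  have : (fun p : α × ℝ => gaussianTransport (κ p.1) p.2) ⁻¹' Iic x =
      {p | cdf (gaussianReal 0 1) p.2 ≤ (κ p.1 (Iic x)).toReal} := by
    ext p
    simp only [mem_preimage, mem_Iic, gaussianTransport_le_iff, mem_ofPred_eq]
    rw [cdf_eq_real (κ p.1)]
    rfl
  rw [this]
  refine measurableSet_le ((monotone_cdf _).measurable.comp measurable_snd) ?_
  exact ((κ.measurable_coe measurableSet_Iic).comp measurable_fst).ennreal_toReal

/-- The change of variables formula (Monge–Ampère equation) for the monotone transport map. -/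
theorem ae_rnDeriv_gaussianTransport_mul_deriv (ν : Measure ℝ) [IsProbabilityMeasure ν]
    (hν : ν ≪ gaussianReal 0 1) :
    ∀ᵐ y ∂(gaussianReal 0 1), (ν.rnDeriv volume (gaussianTransport ν y)).toReal *
      deriv (gaussianTransport ν) y = gaussianPDFReal 0 1 y := by
  have hγ : gaussianReal 0 1 ≪ volume := gaussianReal_absolutelyContinuous 0 one_ne_zero
  have hνV : ν ≪ volume := hν.trans hγ
  have : NullSingletonClass ν := ⟨fun x => hνV (measure_singleton x)⟩
  have h1 : ∀ᵐ y ∂(gaussianReal 0 1), HasDerivAt (cdf ν)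
      (ν.rnDeriv volume (gaussianTransport ν y)).toReal (gaussianTransport ν y) := by
    have h := (cdf ν).ae_hasDerivAt
    rw [measure_cdf] at h
    -- A property holding `ν`-almost everywhere holds at `T y` for `γ`-almost every `y`, because `T`
    -- pushes `γ` to `ν`.
    refine ae_of_ae_map (monotone_gaussianTransport ν).measurable.aemeasurable
      (p := fun x => HasDerivAt (cdf ν) (ν.rnDeriv volume x).toReal x) ?_
    rw [map_gaussianTransport]
    exact hνV.ae_le h
  have h2 := hγ.ae_le (cdf (gaussianReal 0 1)).ae_hasDerivAt
  rw [measure_cdf] at h2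
  have h3 := hγ.ae_le (rnDeriv_gaussianReal 0 1)
  filter_upwards [h1, h2, h3, hγ.ae_le (monotone_gaussianTransport ν).ae_differentiableAt]
    with y h1 h2 h3 h4
  have h5 := h1.comp y h4.hasDerivAt
  have h6 : (cdf ν) ∘ gaussianTransport ν = cdf (gaussianReal 0 1) :=
    funext (cdf_gaussianTransport ν)
  rw [h6] at h5
  rw [h5.unique h2, h3, toReal_gaussianPDF]

/-! ### Gaussian translations and integration by parts -/

theorem gaussianPDFReal_zero_one_sub (y h : ℝ) :
    gaussianPDFReal 0 1 (y - h) = gaussianPDFReal 0 1 y * Real.exp (h * y - h ^ 2 / 2) := by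
  simp only [gaussianPDFReal, NNReal.coe_one]
  rw [mul_assoc _ (Real.exp _) (Real.exp _), ← Real.exp_add]
  congr 2
  ring

/-- The Cameron–Martin formula on the line. It moves the translation off `f` onto a smooth weight,
so that differentiating in `h` needs no regularity of `f`. -/
theorem integral_gaussianReal_comp_add (f : ℝ → ℝ) (h : ℝ) :
    ∫ y, f (y + h) ∂(gaussianReal 0 1) =
      ∫ y, f y * Real.exp (h * y - h ^ 2 / 2) ∂(gaussianReal 0 1) := by
  rw [integral_gaussianReal_eq_integral_smul one_ne_zero,
    integral_gaussianReal_eq_integral_smul one_ne_zero,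
    ← integral_sub_right_eq_self (fun y => gaussianPDFReal 0 1 y • f (y + h)) h]
  congr 1
  ext y
  simp only [gaussianPDFReal_zero_one_sub, smul_eq_mul, sub_add_cancel]
  ring

theorem integrable_gaussianReal_comp_add {f : ℝ → ℝ} {h : ℝ}
    (hf : Integrable (fun y => f y * Real.exp (h * y - h ^ 2 / 2)) (gaussianReal 0 1)) :
    Integrable (fun y => f (y + h)) (gaussianReal 0 1) := by
  rw [gaussianReal_of_var_ne_zero 0 one_ne_zero] at hf ⊢
  rw [integrable_withDensity_iff_integrable_smul' (measurable_gaussianPDF 0 1)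
    (ae_of_all _ fun _ => gaussianPDF_lt_top)] at hf ⊢
  convert hf.comp_add_right h using 1
  ext y
  have := gaussianPDFReal_zero_one_sub (y + h) h
  rw [add_sub_cancel_right] at this
  simp only [toReal_gaussianPDF, smul_eq_mul, this]
  ring

theorem memLp_exp_mul_abs_gaussianReal (c : ℝ) :
    MemLp (fun y => Real.exp (c * |y|)) 2 (gaussianReal 0 1) := by
  rw [memLp_two_iff_integrable_sq (by fun_prop)]
  refine ((integrable_exp_mul_gaussianReal (2 * c)).add
    (integrable_exp_mul_gaussianReal (μ := 0) (v := 1) (-(2 * c)))).mono' (by fun_prop)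
    (ae_of_all _ fun y => ?_)
  rw [Real.norm_of_nonneg (by positivity), ← Real.exp_nat_mul]
  simp only [Pi.add_apply]
  rcases abs_cases y with ⟨h, _⟩ | ⟨h, _⟩
  · have := Real.exp_pos (-(2 * c) * y)
    rw [h, show ((2 : ℕ) : ℝ) * (c * y) = 2 * c * y by push_cast; ring]
    linarith
  · have := Real.exp_pos (2 * c * y)
    rw [h, show ((2 : ℕ) : ℝ) * (c * -y) = -(2 * c) * y by push_cast; ring]
    linarith

theorem MeasureTheory.MemLp.integrable_mul_exp_gaussianReal {f : ℝ → ℝ}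
    (hf : MemLp f 2 (gaussianReal 0 1)) (h : ℝ) :
    Integrable (fun y => f y * Real.exp (h * y - h ^ 2 / 2)) (gaussianReal 0 1) := by
  refine (hf.integrable_mul (memLp_exp_mul_abs_gaussianReal |h|)).mono
    (hf.1.mul (by fun_prop)) (ae_of_all _ fun y => ?_)
  simp only [norm_mul, Pi.mul_apply, Real.norm_eq_abs, Real.abs_exp]
  gcongr
  have := le_abs_self (h * y)
  rw [abs_mul] at this
  nlinarith [sq_nonneg h]

/-- Differentiating Gaussian integrals along translations. -/
theorem hasDerivAt_integral_gaussianReal_comp_add {f : ℝ → ℝ}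
    (hf : MemLp f 2 (gaussianReal 0 1)) :
    HasDerivAt (fun h => ∫ y, f (y + h) ∂(gaussianReal 0 1))
      (∫ y, y * f y ∂(gaussianReal 0 1)) 0 := by
  simp_rw [integral_gaussianReal_comp_add]
  -- For `|h| < 1` both `|y - h|` and the exponential weight are at most `exp |y|`, whence the
  -- dominating factor `exp (2 |y|)`, which is square integrable against `γ`.
  have key := (hasDerivAt_integral_of_dominated_loc_of_deriv_le (μ := gaussianReal 0 1) (x₀ := 0)
    (F := fun h y => f y * Real.exp (h * y - h ^ 2 / 2))
    (F' := fun h y => f y * ((y - h) * Real.exp (h * y - h ^ 2 / 2)))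
    (bound := fun y => ‖f y‖ * Real.exp (2 * |y|)) (s := Metric.ball 0 1)
    (Metric.ball_mem_nhds 0 one_pos)
    (Eventually.of_forall fun h => (hf.integrable_mul_exp_gaussianReal h).1)
    (hf.integrable_mul_exp_gaussianReal 0) (hf.1.mul (by fun_prop))
    (ae_of_all _ fun y h hh => ?_)
    (hf.norm.integrable_mul (memLp_exp_mul_abs_gaussianReal 2))
    (ae_of_all _ fun y h hh => ?_)).2
  · refine key.congr_deriv (integral_congr_ae (ae_of_all _ fun y => ?_))
    simp [mul_comm]
  · rw [mem_ball_zero_iff, Real.norm_eq_abs] at hh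
    simp only [norm_mul, Real.norm_eq_abs, Real.abs_exp]
    gcongr
    have h1 : |y - h| ≤ Real.exp |y| := by
      have := Real.add_one_le_exp |y|
      have := abs_sub y h
      linarith
    calc |y - h| * Real.exp (h * y - h ^ 2 / 2) ≤ Real.exp |y| * Real.exp |y| := by
          gcongr
          have := le_abs_self (h * y)
          rw [abs_mul] at this
          nlinarith [sq_nonneg h, abs_nonneg y]
      _ = Real.exp (2 * |y|) := by rw [← Real.exp_add]; ring_nf
  · have h1 : HasDerivAt (fun h : ℝ => h * y - h ^ 2 / 2) (y - h) h := by
      have := ((hasDerivAt_id h).mul_const y).sub (((hasDerivAt_id h).pow 2).div_const 2)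
      refine this.congr_deriv ?_
      simp
    refine ((h1.exp).const_mul (f y)).congr_deriv ?_
    ring

/-- Gaussian integration by parts, as an inequality, for monotone functions. -/
theorem Monotone.lintegral_deriv_gaussianReal_le {f : ℝ → ℝ} (hm : Monotone f)
    (hf : MemLp f 2 (gaussianReal 0 1)) :
    ∫⁻ y, ENNReal.ofReal (deriv f y) ∂(gaussianReal 0 1) ≤
      ENNReal.ofReal (∫ y, y * f y ∂(gaussianReal 0 1)) := by
  have hγ : gaussianReal 0 1 ≪ volume := gaussianReal_absolutelyContinuous 0 one_ne_zero
  have hu : Tendsto (fun k : ℕ => (1 / ((k : ℝ) + 1))) atTop (𝓝[≠] 0) :=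
    tendsto_nhdsWithin_iff.2 ⟨tendsto_one_div_add_atTop_nhds_zero_nat,
      Eventually.of_forall fun k => by simp; positivity⟩
  set u : ℕ → ℝ := fun k => 1 / ((k : ℝ) + 1)
  have hupos : ∀ k, 0 < u k := fun k => by positivity
  have hint : ∀ h, Integrable (fun y => f (y + h)) (gaussianReal 0 1) := fun h =>
    integrable_gaussianReal_comp_add (hf.integrable_mul_exp_gaussianReal h)
  have hint0 : Integrable f (gaussianReal 0 1) := by simpa using hint 0
  have hlim : Tendsto (fun k => ENNReal.ofReal
      (∫ y, (u k)⁻¹ * (f (y + u k) - f y) ∂(gaussianReal 0 1))) atTop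
      (𝓝 (ENNReal.ofReal (∫ y, y * f y ∂(gaussianReal 0 1)))) := by
    refine ENNReal.tendsto_ofReal ?_
    refine ((hasDerivAt_integral_gaussianReal_comp_add hf).tendsto_slope_zero.comp hu).congr
      fun k => ?_
    simp only [Function.comp, zero_add, add_zero, smul_eq_mul]
    rw [integral_const_mul, integral_sub (hint _) hint0]
  -- The difference quotients of a monotone function are nonnegative and converge almost everywhere
  -- to the derivative. Fatou's lemma then gives an inequality, the loss being the singular part of
  -- `df`.
  rw [← hlim.liminf_eq]
  calc ∫⁻ y, ENNReal.ofReal (deriv f y) ∂(gaussianReal 0 1)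
      = ∫⁻ y, liminf (fun k => ENNReal.ofReal ((u k)⁻¹ * (f (y + u k) - f y))) atTop
          ∂(gaussianReal 0 1) := by
        refine lintegral_congr_ae ?_
        filter_upwards [hγ.ae_le hm.ae_differentiableAt] with y hy
        refine (Tendsto.liminf_eq (ENNReal.tendsto_ofReal ?_)).symm
        exact hy.hasDerivAt.tendsto_slope_zero.comp hu
    _ ≤ liminf (fun k => ∫⁻ y, ENNReal.ofReal ((u k)⁻¹ * (f (y + u k) - f y))
          ∂(gaussianReal 0 1)) atTop :=
        lintegral_liminf_le fun k => by
          have := hm.measurable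
          fun_prop
    _ = _ := by
        congr 1
        ext k
        refine (ofReal_integral_eq_lintegral_ofReal (((hint (u k)).sub hint0).const_mul _) ?_).symm
        exact ae_of_all _ fun y => mul_nonneg (inv_nonneg.2 (hupos k).le)
          (sub_nonneg.2 (hm (by linarith [hupos k])))

/-! ### Talagrand's inequality on the line -/

theorem integral_sq_gaussianReal : ∫ y, y ^ 2 ∂(gaussianReal 0 1) = 1 := by
  have h := variance_id_gaussianReal (μ := 0) (v := 1)
  rw [variance_eq_sub (memLp_id_gaussianReal 2)] at h
  simpa using h

theorem log_gaussianPDFReal_zero_one (y : ℝ) :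
    Real.log (gaussianPDFReal 0 1 y) = -(Real.log (2 * Real.pi) / 2) - y ^ 2 / 2 := by
  simp only [gaussianPDFReal, NNReal.coe_one, mul_one, sub_zero]
  rw [Real.log_mul (by positivity) (Real.exp_ne_zero _), Real.log_exp, Real.log_inv,
    Real.log_sqrt (by positivity)]
  ring

/-- This is the logarithm of the Monge–Ampère equation. Its right side is a positive Gaussian
density, which forces both factors on the left to be positive, so the logarithms split. -/
theorem ae_llr_gaussianTransport (ν : Measure ℝ) [IsProbabilityMeasure ν]
    (hν : ν ≪ gaussianReal 0 1) :
    ∀ᵐ y ∂(gaussianReal 0 1), 0 < deriv (gaussianTransport ν) y ∧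
      llr ν (gaussianReal 0 1) (gaussianTransport ν y) =
        gaussianTransport ν y ^ 2 / 2 - y ^ 2 / 2 - Real.log (deriv (gaussianTransport ν) y) := by
  have hγ : gaussianReal 0 1 ≪ volume := gaussianReal_absolutelyContinuous 0 one_ne_zero
  have h1 : ∀ᵐ y ∂(gaussianReal 0 1),
      (ν.rnDeriv (gaussianReal 0 1) (gaussianTransport ν y)).toReal *
        gaussianPDFReal 0 1 (gaussianTransport ν y) =
      (ν.rnDeriv volume (gaussianTransport ν y)).toReal := by
    refine ae_of_ae_map (monotone_gaussianTransport ν).measurable.aemeasurable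
      (p := fun x => (ν.rnDeriv (gaussianReal 0 1) x).toReal * gaussianPDFReal 0 1 x =
        (ν.rnDeriv volume x).toReal) ?_
    rw [map_gaussianTransport]
    filter_upwards [(hν.trans hγ).ae_le (Measure.rnDeriv_mul_rnDeriv hν (κ := volume)),
      (hν.trans hγ).ae_le (rnDeriv_gaussianReal 0 1)] with x hx hx'
    rw [← hx, Pi.mul_apply, ENNReal.toReal_mul, hx', toReal_gaussianPDF]
  filter_upwards [h1, ae_rnDeriv_gaussianTransport_mul_deriv ν hν] with y h1 h2
  have hpos := gaussianPDFReal_pos 0 1 y one_ne_zero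
  have hpos' := gaussianPDFReal_pos 0 1 (gaussianTransport ν y) one_ne_zero
  rw [← h2] at hpos
  have hd : 0 < deriv (gaussianTransport ν) y := pos_of_mul_pos_right hpos ENNReal.toReal_nonneg
  have hr := pos_of_mul_pos_left hpos hd.le
  rw [← h1] at hr h2
  have hr' := pos_of_mul_pos_left hr hpos'.le
  refine ⟨hd, ?_⟩
  have h3 := congrArg Real.log h2
  rw [Real.log_mul (by positivity) hd.ne', Real.log_mul hr'.ne' hpos'.ne',
    log_gaussianPDFReal_zero_one, log_gaussianPDFReal_zero_one] at h3
  rw [llr]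
  linarith

/-- **Talagrand's transportation inequality** on the real line, for the monotone transport. -/
theorem lintegral_gaussianTransport_sub_sq_le (ν : Measure ℝ) [IsProbabilityMeasure ν]
    (hν : ν ≪ gaussianReal 0 1) (h2 : MemLp id 2 ν) :
    ∫⁻ y, ENNReal.ofReal ((gaussianTransport ν y - y) ^ 2) ∂(gaussianReal 0 1) ≤
      2 * klDiv ν (gaussianReal 0 1) := by
  by_cases hint : Integrable (llr ν (gaussianReal 0 1)) ν
  swap
  · simp [klDiv_of_not_integrable hint]
  set T := gaussianTransport ν with hT
  have hm : Monotone T := monotone_gaussianTransport ν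
  have hTmeas : AEMeasurable T (gaussianReal 0 1) := hm.measurable.aemeasurable
  have hmap : (gaussianReal 0 1).map T = ν := map_gaussianTransport ν
  have hT2 : MemLp T 2 (gaussianReal 0 1) := by
    rw [← hmap] at h2
    exact h2.comp_of_map hTmeas
  have hid : MemLp id 2 (gaussianReal 0 1) := memLp_id_gaussianReal 2
  have hTsq : Integrable (fun y => T y ^ 2) (gaussianReal 0 1) := hT2.integrable_sq
  have hysq : Integrable (fun y : ℝ => y ^ 2) (gaussianReal 0 1) := hid.integrable_sq
  have hyT : Integrable (fun y : ℝ => y * T y) (gaussianReal 0 1) := hid.integrable_mul hT2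
  have hle := hm.lintegral_deriv_gaussianReal_le hT2
  have hdpos : ∀ y, 0 ≤ deriv T y := fun y => hm.deriv_nonneg
  have hdint : Integrable (deriv T) (gaussianReal 0 1) :=
    ⟨(measurable_deriv T).aestronglyMeasurable, by
      rw [hasFiniteIntegral_iff_ofReal (ae_of_all _ hdpos)]
      exact hle.trans_lt ENNReal.ofReal_lt_top⟩
  have hL : Integrable (fun y => llr ν (gaussianReal 0 1) (T y)) (gaussianReal 0 1) := by
    have h := hint
    nth_rewrite 2 [← hmap] at h
    exact h.comp_aemeasurable hTmeas
  have hLeq : ∫ x, llr ν (gaussianReal 0 1) x ∂ν =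
      ∫ y, llr ν (gaussianReal 0 1) (T y) ∂(gaussianReal 0 1) := by
    rw [← integral_map (f := llr ν (gaussianReal 0 1)) hTmeas
      (measurable_llr _ _).aestronglyMeasurable, hmap]
  have hdle : ∫ y, deriv T y ∂(gaussianReal 0 1) ≤ ∫ y, y * T y ∂(gaussianReal 0 1) := by
    rw [← ofReal_integral_eq_lintegral_ofReal hdint (ae_of_all _ hdpos)] at hle
    have hnn : 0 ≤ ∫ y, deriv T y ∂(gaussianReal 0 1) := integral_nonneg hdpos
    by_contra! hlt
    -- `ENNReal.ofReal` truncates at zero, so the comparison could be lost if `∫ T' = 0`; this is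
    -- excluded because `T' > 0` almost everywhere.
    refine absurd ((ENNReal.ofReal_lt_ofReal_iff (lt_of_le_of_ne hnn fun h0 => ?_)).2 hlt)
      (not_lt.2 hle)
    have h := (integral_eq_zero_iff_of_nonneg hdpos hdint).1 h0.symm
    obtain ⟨y, hy, hy'⟩ := (h.and (ae_llr_gaussianTransport ν hν)).exists
    exact hy'.1.ne' hy
  have hmain : ∫ y, (T y - y) ^ 2 / 2 ∂(gaussianReal 0 1) ≤ ∫ x, llr ν (gaussianReal 0 1) x ∂ν := by
    have e1 : ∫ y, (T y - y) ^ 2 / 2 ∂(gaussianReal 0 1) =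
        ∫ y, (T y ^ 2 / 2 - y ^ 2 / 2) ∂(gaussianReal 0 1) + 1
          - ∫ y, y * T y ∂(gaussianReal 0 1) := by
      rw [← integral_sq_gaussianReal, ← integral_add (by fun_prop) hysq,
        ← integral_sub (by fun_prop) hyT]
      congr 1; ext y; ring
    have e2 : ∫ y, (T y ^ 2 / 2 - y ^ 2 / 2) ∂(gaussianReal 0 1) + 1
          - ∫ y, deriv T y ∂(gaussianReal 0 1) =
        ∫ y, (T y ^ 2 / 2 - y ^ 2 / 2 + 1 - deriv T y) ∂(gaussianReal 0 1) := by
      rw [integral_sub (by fun_prop) hdint, integral_add (by fun_prop) (by fun_prop)]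
      simp
    -- The pointwise bound `log T' ≤ T' - 1`, inserted in the formula for the log-likelihood ratio.
    -- The constant 1 matches the second moment of `γ` in the expansion of the square.
    have e3 : ∫ y, (T y ^ 2 / 2 - y ^ 2 / 2 + 1 - deriv T y) ∂(gaussianReal 0 1) ≤
        ∫ y, llr ν (gaussianReal 0 1) (T y) ∂(gaussianReal 0 1) := by
      refine integral_mono_ae (by fun_prop) hL ?_
      filter_upwards [ae_llr_gaussianTransport ν hν] with y ⟨hy, hy'⟩
      have := Real.log_le_sub_one_of_pos hy
      simp only [hT] at *
      linarith
    linarith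
  rw [klDiv_of_ac_of_integrable hν hint]
  simp only [probReal_univ, add_sub_cancel_right]
  have hint3 : Integrable (fun y => (T y - y) ^ 2) (gaussianReal 0 1) := (hT2.sub hid).integrable_sq
  rw [← ofReal_integral_eq_lintegral_ofReal hint3 (ae_of_all _ fun y => sq_nonneg _),
    show (2 : ℝ≥0∞) = ENNReal.ofReal 2 by simp, ← ENNReal.ofReal_mul zero_le_two]
  refine ENNReal.ofReal_le_ofReal ?_
  rw [integral_div] at hmain
  linarith

/-! ### Conditional relative entropy and tensorization -/

section CondKL

variable {α β : Type*} [MeasurableSpace α] [MeasurableSpace β]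
  [MeasurableSpace.CountableOrCountablyGenerated α β]

theorem compProd_eq_withDensity_rnDeriv (μ : Measure α) [SFinite μ] (κ η : Kernel α β)
    [IsFiniteKernel κ] [IsFiniteKernel η] (h : ∀ᵐ x ∂μ, κ x ≪ η x) :
    μ ⊗ₘ κ = (μ ⊗ₘ η).withDensity (fun p => κ.rnDeriv η p.1 p.2) := by
  have hm : Measurable fun p : α × β => κ.rnDeriv η p.1 p.2 := Kernel.measurable_rnDeriv κ η
  ext s hs
  rw [Measure.compProd_apply hs, withDensity_apply _ hs, ← lintegral_indicator hs,
    Measure.lintegral_compProd (hm.indicator hs)]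
  refine lintegral_congr_ae ?_
  filter_upwards [h] with x hx
  rw [← Kernel.setLIntegral_rnDeriv hx (measurable_prodMk_left hs),
    ← lintegral_indicator (measurable_prodMk_left hs)]
  rfl

/-- The conditional Kullback–Leibler divergence is the average of the divergences of the
conditional laws. -/
theorem klDiv_compProd_right_eq_lintegral (μ : Measure α) [IsFiniteMeasure μ] (κ η : Kernel α β)
    [IsFiniteKernel κ] [IsFiniteKernel η] (h : ∀ᵐ x ∂μ, κ x ≪ η x) :
    klDiv (μ ⊗ₘ κ) (μ ⊗ₘ η) = ∫⁻ x, klDiv (κ x) (η x) ∂μ := by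
  have hm : Measurable fun p : α × β => κ.rnDeriv η p.1 p.2 := Kernel.measurable_rnDeriv κ η
  have hk := measurable_klFun
  rw [klDiv_eq_lintegral_klFun_of_ac (Measure.absolutelyContinuous_compProd_right_iff.2 h)]
  have h1 : (μ ⊗ₘ κ).rnDeriv (μ ⊗ₘ η) =ᵐ[μ ⊗ₘ η] fun p => κ.rnDeriv η p.1 p.2 := by
    rw [compProd_eq_withDensity_rnDeriv μ κ η h]
    exact Measure.rnDeriv_withDensity _ hm
  rw [lintegral_congr_ae (g := fun p => ENNReal.ofReal (klFun (κ.rnDeriv η p.1 p.2).toReal))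
    (h1.mono fun p hp => by simp only [hp]), Measure.lintegral_compProd (by fun_prop)]
  refine lintegral_congr_ae ?_
  filter_upwards [h] with x hx
  rw [klDiv_eq_lintegral_klFun_of_ac hx]
  refine lintegral_congr_ae ?_
  filter_upwards [Kernel.rnDeriv_eq_rnDeriv_measure (κ := κ) (η := η) (a := x)] with y hy
  rw [hy]

end CondKL

/-- Tensorization: the transport inequality for `μ` and for the standard Gaussian measure on `ℝ`
yields the transport inequality for their product. -/
theorem exists_coupling_prod_gaussianReal {X : Type*} [MeasurableSpace X] {μ : Measure X}
    [IsProbabilityMeasure μ] {P : Measure (X × ℝ)} [IsProbabilityMeasure P]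
    (hP : P ≪ μ.prod (gaussianReal 0 1)) (h2 : ∫⁻ p, ENNReal.ofReal (p.2 ^ 2) ∂P ≠ ∞)
    {c : X × X → ℝ≥0∞} (hc : Measurable c) {π : Measure (X × X)} (hπ : π ∈ couplings P.fst μ)
    (hcost : ∫⁻ z, c z ∂π ≤ 2 * klDiv P.fst μ) :
    ∃ ρ ∈ couplings P (μ.prod (gaussianReal 0 1)),
      ∫⁻ z, (c (z.1.1, z.2.1) + ENNReal.ofReal ((z.1.2 - z.2.2) ^ 2)) ∂ρ ≤
        2 * klDiv P (μ.prod (gaussianReal 0 1)) := by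
  obtain ⟨hπp, hπ1, hπ2⟩ := hπ
  set κ := P.condKernel with hκ
  have hdis : P.fst ⊗ₘ κ = P := P.disintegrate P.condKernel
  have hT := measurable_gaussianTransport_kernel κ
  have hac' : P.fst ⊗ₘ κ ≪ μ ⊗ₘ Kernel.const X (gaussianReal 0 1) := by
    rwa [hdis, Measure.compProd_const]
  have hac : ∀ᵐ x ∂P.fst, κ x ≪ gaussianReal 0 1 := by
    simpa using hac'.kernel_of_compProd
  have hmom : ∀ᵐ x ∂P.fst, MemLp id 2 (κ x) := by
    rw [← hdis, Measure.lintegral_compProd (by fun_prop)] at h2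
    have hf : Measurable fun p : X × ℝ => ENNReal.ofReal (p.2 ^ 2) := by fun_prop
    filter_upwards [ae_lt_top hf.lintegral_kernel_prod_right' h2] with x hx
    rw [memLp_two_iff_integrable_sq (by fun_prop)]
    exact ⟨by fun_prop, by
      rw [hasFiniteIntegral_iff_ofReal (ae_of_all _ fun _ => sq_nonneg _)]; exact hx⟩
  -- The chain rule: the first term pays for the coupling already given on `X`, the second for the
  -- conditional transports of the real coordinate.
  have hkl : klDiv P (μ.prod (gaussianReal 0 1)) =
      klDiv P.fst μ + ∫⁻ x, klDiv (κ x) (gaussianReal 0 1) ∂P.fst := by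
    conv_lhs => rw [← hdis, ← Measure.compProd_const]
    rw [klDiv_compProd_eq_add, klDiv_compProd_right_eq_lintegral]
    · simp
    · simpa using hac
  -- Couple the `X`-coordinates by `π` and draw an independent Gaussian `y`. On the `P` side, send
  -- `y` through the monotone map of the conditional law at the first point; on the Gaussian side
  -- keep `y`, which preserves the product structure.
  let Φ : (X × X) × ℝ → (X × ℝ) × (X × ℝ) :=
    fun w => ((w.1.1, gaussianTransport (κ w.1.1) w.2), (w.1.2, w.2))
  have hΦ1 : Measurable fun w : (X × X) × ℝ => gaussianTransport (κ w.1.1) w.2 :=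
    hT.comp (by fun_prop : Measurable fun w : (X × X) × ℝ => (w.1.1, w.2))
  have hΦ : Measurable Φ := by fun_prop
  refine ⟨(π.prod (gaussianReal 0 1)).map Φ,
    ⟨Measure.isProbabilityMeasure_map hΦ.aemeasurable, ?_, ?_⟩, ?_⟩
  · rw [Measure.fst, Measure.map_map measurable_fst hΦ]
    have h1 : Prod.fst ∘ Φ = (fun p : X × ℝ => (p.1, gaussianTransport (κ p.1) p.2)) ∘
        Prod.map Prod.fst id := rfl
    rw [h1, ← Measure.map_map (by fun_prop) (by fun_prop), ← Measure.map_prod_map _ _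
      measurable_fst measurable_id, Measure.map_id, ← Measure.fst, hπ1]
    conv_rhs => rw [← hdis]
    ext s hs
    rw [Measure.map_apply (by fun_prop) hs, Measure.prod_apply
      ((by fun_prop : Measurable fun p : X × ℝ => (p.1, gaussianTransport (κ p.1) p.2)) hs),
      Measure.compProd_apply hs]
    refine lintegral_congr fun x => ?_
    conv_rhs => rw [← map_gaussianTransport (κ x)]
    rw [Measure.map_apply (monotone_gaussianTransport _).measurable (measurable_prodMk_left hs)]
    rfl
  · rw [Measure.snd, Measure.map_map measurable_snd hΦ]
    have h1 : Prod.snd ∘ Φ = Prod.map Prod.snd id := rfl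
    rw [h1, ← Measure.map_prod_map _ _ measurable_snd measurable_id, Measure.map_id,
      ← Measure.snd, hπ2]
  · rw [lintegral_map (by fun_prop) hΦ, lintegral_add_left (by fun_prop), hkl, mul_add]
    refine add_le_add ?_ ?_
    · rw [lintegral_prod _ (by fun_prop)]
      simpa [Φ] using hcost
    · rw [lintegral_prod _ (by fun_prop), ← lintegral_const_mul' _ _ (by simp)]
      have hG : Measurable fun x => ∫⁻ y, ENNReal.ofReal ((gaussianTransport (κ x) y - y) ^ 2)
          ∂(gaussianReal 0 1) :=
        Measurable.lintegral_prod_right'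
          (f := fun p : X × ℝ => ENNReal.ofReal ((gaussianTransport (κ p.1) p.2 - p.2) ^ 2))
          (by fun_prop)
      -- The inner cost depends only on the first point, so only the marginal `P.fst` of `π`
      -- matters.
      change ∫⁻ z : X × X, (fun x => ∫⁻ y, ENNReal.ofReal ((gaussianTransport (κ x) y - y) ^ 2)
          ∂(gaussianReal 0 1)) z.1 ∂π ≤ _
      rw [← lintegral_map hG measurable_fst, ← Measure.fst, hπ1]
      refine lintegral_mono_ae ?_
      filter_upwards [hac, hmom] with x hx hx'
      exact lintegral_gaussianTransport_sub_sq_le _ hx hx'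

theorem exists_coupling_pi_gaussianReal (n : ℕ) (P : Measure (Fin n → ℝ))
    [IsProbabilityMeasure P] (hP : P ≪ Measure.pi fun _ => gaussianReal 0 1)
    (h2 : ∀ i, ∫⁻ x, ENNReal.ofReal (x i ^ 2) ∂P ≠ ∞) :
    ∃ ρ ∈ couplings P (Measure.pi fun _ => gaussianReal 0 1),
      ∫⁻ z, ∑ i, ENNReal.ofReal ((z.1 i - z.2 i) ^ 2) ∂ρ ≤
        2 * klDiv P (Measure.pi fun _ => gaussianReal 0 1) := by
  induction n with
  | zero =>
    refine ⟨P.prod (Measure.pi fun _ => gaussianReal 0 1), ⟨inferInstance, by simp, by simp⟩, ?_⟩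
    simp
  | succ n ih =>
    set γ : Measure (Fin n → ℝ) := Measure.pi fun _ => gaussianReal 0 1 with hγ
    -- Coordinate `0` is split off and placed last, to fit the product `X × ℝ` of the tensorization
    -- step.
    let e := (MeasurableEquiv.piFinSuccAbove (fun _ : Fin (n + 1) => ℝ) 0).trans
      MeasurableEquiv.prodComm
    have he : ∀ x, e x = (fun i : Fin n => x i.succ, x 0) := fun x => rfl
    have hmp : (Measure.pi fun _ : Fin (n + 1) => gaussianReal 0 1).map e =
        γ.prod (gaussianReal 0 1) := by
      have h1 := (measurePreserving_piFinSuccAbove (fun _ : Fin (n + 1) => gaussianReal 0 1) 0)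
      exact ((Measure.measurePreserving_swap).comp h1).map_eq
    set Q := P.map e with hQ
    have : IsProbabilityMeasure Q := Measure.isProbabilityMeasure_map e.measurable.aemeasurable
    have hQac : Q ≪ γ.prod (gaussianReal 0 1) := by
      rw [← hmp]; exact hP.map e.measurable
    have hQ1 : Q.fst = P.map fun x i => x i.succ := by
      rw [Measure.fst, hQ, Measure.map_map measurable_fst e.measurable]; rfl
    have hQ1ac : Q.fst ≪ γ := by
      have := hQac.map (measurable_fst)
      rwa [← Measure.fst, ← Measure.fst, Measure.fst_prod] at this
    obtain ⟨π, hπ, hcost⟩ := ih Q.fst hQ1ac fun i => by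
      rw [hQ1, lintegral_map (by fun_prop) (by fun_prop)]
      exact h2 i.succ
    obtain ⟨ρ, ⟨hρ, hρ1, hρ2⟩, hρc⟩ := exists_coupling_prod_gaussianReal hQac
      (by rw [hQ, lintegral_map (by fun_prop) e.measurable]; exact h2 0)
      (by fun_prop) hπ hcost
    have hem : Measurable (Prod.map e.symm e.symm) := by fun_prop
    -- Only this direction is needed, and it is the data-processing inequality.
    have hkl : klDiv Q (γ.prod (gaussianReal 0 1)) ≤
        klDiv P (Measure.pi fun _ => gaussianReal 0 1) := by
      rw [hQ, ← hmp]; exact klDiv_map_le _ _ e.measurable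
    refine ⟨ρ.map (Prod.map e.symm e.symm), ⟨Measure.isProbabilityMeasure_map hem.aemeasurable,
      ?_, ?_⟩, ?_⟩
    · rw [Measure.fst, Measure.map_map measurable_fst hem]
      change ρ.map (e.symm ∘ Prod.fst) = P
      rw [← Measure.map_map e.symm.measurable measurable_fst, ← Measure.fst, hρ1, hQ,
        MeasurableEquiv.map_symm_map]
    · rw [Measure.snd, Measure.map_map measurable_snd hem]
      change ρ.map (e.symm ∘ Prod.snd) = _
      rw [← Measure.map_map e.symm.measurable measurable_snd, ← Measure.snd, hρ2, ← hmp,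
        MeasurableEquiv.map_symm_map]
    · rw [lintegral_map (by fun_prop) hem]
      refine le_trans (le_of_eq (lintegral_congr fun z => ?_))
        (hρc.trans (mul_le_mul_right hkl 2))
      obtain ⟨z1, z2⟩ := z
      obtain ⟨x, rfl⟩ := e.surjective z1
      obtain ⟨y, rfl⟩ := e.surjective z2
      simp only [Prod.map_apply, MeasurableEquiv.symm_apply_apply]
      rw [Fin.sum_univ_succ, add_comm]
      simp only [he]

/-! ### Lebesgue densities and differential entropy -/

theorem pi_gaussianReal_eq_withDensity (n : ℕ) :
    (Measure.pi fun _ : Fin n => gaussianReal 0 1) =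
      (volume : Measure (Fin n → ℝ)).withDensity
        fun x => ENNReal.ofReal (∏ i, gaussianPDFReal 0 1 (x i)) := by
  refine Measure.pi_eq fun s hs => ?_
  have hnn : ∀ x : Fin n → ℝ, 0 ≤ ∏ i, gaussianPDFReal 0 1 (x i) := fun x =>
    Finset.prod_nonneg fun i _ => gaussianPDFReal_nonneg 0 1 _
  have hi : ∀ i, Integrable (gaussianPDFReal 0 1) (volume.restrict (s i)) := fun i =>
    (integrable_gaussianPDFReal 0 1).restrict
  rw [withDensity_apply _ (MeasurableSet.univ_pi hs), volume_pi, Measure.restrict_pi_pi,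
    ← ofReal_integral_eq_lintegral_ofReal (Integrable.fintype_prod hi) (ae_of_all _ hnn),
    integral_fintype_prod_eq_prod (fun _ : Fin n => gaussianPDFReal 0 1),
    ENNReal.ofReal_prod_of_nonneg fun i _ => integral_nonneg fun y => gaussianPDFReal_nonneg 0 1 y]
  refine Finset.prod_congr rfl fun i _ => ?_
  rw [gaussianReal_apply_eq_integral 0 one_ne_zero]

theorem stdGaussian_eq_withDensity (n : ℕ) :
    stdGaussian (EuclideanSpace ℝ (Fin n)) = volume.withDensity
      fun x => ENNReal.ofReal (Real.exp (-(‖x‖ ^ 2 / 2) - n / 2 * Real.log (2 * Real.pi))) := by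
  rw [← map_pi_eq_stdGaussian, pi_gaussianReal_eq_withDensity,
    ← (PiLp.volume_preserving_toLp (Fin n)).map_eq]
  ext s hs
  have hm : Measurable (WithLp.toLp 2 : (Fin n → ℝ) → EuclideanSpace ℝ (Fin n)) := by fun_prop
  rw [Measure.map_apply hm hs, withDensity_apply _ (hm hs), withDensity_apply _ hs,
    setLIntegral_map hs (by fun_prop) hm]
  refine lintegral_congr fun x => ?_
  congr 1
  have hpos : ∀ i, 0 < gaussianPDFReal 0 1 (x i) := fun i => gaussianPDFReal_pos 0 1 _ one_ne_zero
  rw [← Real.exp_log (Finset.prod_pos fun i _ => hpos i),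
    Real.log_prod fun i _ => (hpos i).ne']
  simp only [log_gaussianPDFReal_zero_one, Finset.sum_sub_distrib, EuclideanSpace.real_norm_sq_eq,
    Finset.sum_const, Finset.card_univ, Fintype.card_fin, nsmul_eq_mul, Finset.sum_div]
  congr 1
  ring

theorem stdGaussian_absolutelyContinuous_volume (n : ℕ) :
    stdGaussian (EuclideanSpace ℝ (Fin n)) ≪ volume := by
  rw [stdGaussian_eq_withDensity]
  exact withDensity_absolutelyContinuous _ _

theorem lebesgueDensity_stdGaussian (n : ℕ) :
    ∀ᵐ x, lebesgueDensity (stdGaussian (EuclideanSpace ℝ (Fin n))) x =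
      Real.exp (-(‖x‖ ^ 2 / 2) - n / 2 * Real.log (2 * Real.pi)) := by
  have h : (stdGaussian (EuclideanSpace ℝ (Fin n))).rnDeriv volume =ᵐ[volume]
      fun x => ENNReal.ofReal (Real.exp (-(‖x‖ ^ 2 / 2) - n / 2 * Real.log (2 * Real.pi))) := by
    rw [stdGaussian_eq_withDensity]
    exact Measure.rnDeriv_withDensity _ (by fun_prop)
  filter_upwards [h] with x hx
  rw [lebesgueDensity, hx, ENNReal.toReal_ofReal (Real.exp_pos _).le]

theorem measurable_lebesgueDensity {E : Type*} [MeasureSpace E] (P : Measure E) :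
    Measurable (lebesgueDensity P) :=
  (Measure.measurable_rnDeriv P volume).ennreal_toReal

theorem lebesgueDensity_pos {E : Type*} [MeasureSpace E] {P : Measure E} [SigmaFinite P]
    [SigmaFinite (volume : Measure E)] (hP : P ≪ volume) : ∀ᵐ x ∂P, 0 < lebesgueDensity P x := by
  filter_upwards [Measure.rnDeriv_pos hP, hP.ae_le (Measure.rnDeriv_ne_top P volume)] with x h1 h2
  exact ENNReal.toReal_pos h1.ne' h2

/-- The log-likelihood ratio with respect to the standard Gaussian measure, in terms of the
Lebesgue density. -/
theorem llr_stdGaussian {n : ℕ} {P : Measure (EuclideanSpace ℝ (Fin n))} [IsProbabilityMeasure P]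
    (hP : P ≪ stdGaussian (EuclideanSpace ℝ (Fin n))) :
    ∀ᵐ x ∂P, llr P (stdGaussian (EuclideanSpace ℝ (Fin n))) x =
      Real.log (lebesgueDensity P x) + ‖x‖ ^ 2 / 2 + n / 2 * Real.log (2 * Real.pi) := by
  have hV := hP.trans (stdGaussian_absolutelyContinuous_volume n)
  filter_upwards [hV.ae_le (Measure.rnDeriv_mul_rnDeriv hP (κ := volume)),
    hV.ae_le (lebesgueDensity_stdGaussian n), lebesgueDensity_pos hV] with x h1 h2 h3
  have h4 := congrArg ENNReal.toReal h1
  rw [Pi.mul_apply, ENNReal.toReal_mul] at h4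
  change _ * lebesgueDensity (stdGaussian (EuclideanSpace ℝ (Fin n))) x = lebesgueDensity P x at h4
  rw [h2] at h4
  rw [← h4] at h3 ⊢
  have h5 := pos_of_mul_pos_left h3 (Real.exp_pos _).le
  rw [Real.log_mul h5.ne' (Real.exp_ne_zero _), Real.log_exp, llr]
  ring

/-- One factor `f` of `f log f` is absorbed into the measure, so that entropy becomes a statement
about integrability of `log f` under `P`. -/
theorem differentialEntropy_eq_lintegral {E : Type*} [MeasureSpace E] {P : Measure E}
    [IsProbabilityMeasure P] [SigmaFinite (volume : Measure E)] (hP : P ≪ volume) :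
    differentialEntropy P =
      ((∫⁻ x, ENNReal.ofReal (-Real.log (lebesgueDensity P x)) ∂P : ℝ≥0∞) : EReal) -
        ((∫⁻ x, ENNReal.ofReal (Real.log (lebesgueDensity P x)) ∂P : ℝ≥0∞) : EReal) := by
  have hm := measurable_lebesgueDensity P
  have key : ∀ x, P.rnDeriv volume x ≠ ∞ →
      P.rnDeriv volume x = ENNReal.ofReal (lebesgueDensity P x) := fun x hx =>
    (ENNReal.ofReal_toReal hx).symm
  rw [differentialEntropy, ← lintegral_rnDeriv_mul hP (by fun_prop),
    ← lintegral_rnDeriv_mul hP (by fun_prop)]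
  congr 2
  · refine lintegral_congr_ae ?_
    filter_upwards [Measure.rnDeriv_ne_top P volume] with x hx
    rw [key x hx, ← ENNReal.ofReal_mul (p := lebesgueDensity P x) ENNReal.toReal_nonneg,
      Real.negMulLog]
    ring_nf
  · refine lintegral_congr_ae ?_
    filter_upwards [Measure.rnDeriv_ne_top P volume] with x hx
    rw [key x hx, ← ENNReal.ofReal_mul (p := lebesgueDensity P x) ENNReal.toReal_nonneg,
      Real.negMulLog]
    ring_nf

theorem differentialEntropy_eq_integral {E : Type*} [MeasureSpace E] {P : Measure E}
    [IsProbabilityMeasure P] [SigmaFinite (volume : Measure E)] (hP : P ≪ volume)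
    (hint : Integrable (fun x => Real.log (lebesgueDensity P x)) P) :
    differentialEntropy P = ((-∫ x, Real.log (lebesgueDensity P x) ∂P : ℝ) : EReal) := by
  have h1 := hint.lintegral_lt_top
  have hneg : Integrable (fun x => -Real.log (lebesgueDensity P x)) P := hint.neg
  have h2 := hneg.lintegral_lt_top
  rw [differentialEntropy_eq_lintegral hP, ← integral_neg,
    integral_eq_lintegral_pos_part_sub_lintegral_neg_part hneg]
  simp only [neg_neg]
  rw [EReal.coe_sub, ← EReal.coe_ennreal_toReal h2.ne, ← EReal.coe_ennreal_toReal h1.ne]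

/-- Under `Q` the integrand becomes `-t log t`, which is at most `1 - t ≤ 1`. Thus the negative part
of the log-likelihood ratio is always integrable. -/
theorem lintegral_neg_llr_le_one {α : Type*} [MeasurableSpace α] {P Q : Measure α}
    [IsProbabilityMeasure P] [IsProbabilityMeasure Q] (hP : P ≪ Q) :
    ∫⁻ x, ENNReal.ofReal (-llr P Q x) ∂P ≤ 1 := by
  have hm := measurable_llr P Q
  rw [← lintegral_rnDeriv_mul hP (by fun_prop)]
  calc _ ≤ ∫⁻ _, 1 ∂Q := by
        refine lintegral_mono_ae ?_
        filter_upwards [Measure.rnDeriv_ne_top P Q] with x hx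
        rw [llr]
        conv_lhs => enter [1]; rw [← ENNReal.ofReal_toReal hx]
        rw [← ENNReal.ofReal_mul ENNReal.toReal_nonneg]
        have h0 : 0 ≤ (P.rnDeriv Q x).toReal := ENNReal.toReal_nonneg
        have := Real.negMulLog_le_one_sub_self h0
        rw [Real.negMulLog] at this
        exact ENNReal.ofReal_le_one.2 (by linarith)
    _ = 1 := by simp

theorem enorm_sq_eq_ofReal {E : Type*} [NormedAddCommGroup E] (x : E) :
    ‖x‖ₑ ^ 2 = ENNReal.ofReal (‖x‖ ^ 2) := by
  rw [ENNReal.ofReal_pow (norm_nonneg x), ofReal_norm]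

theorem secondMoment_eq_ofReal_integral {E : Type*} [NormedAddCommGroup E] [MeasurableSpace E]
    [BorelSpace E] [SecondCountableTopology E] {P : Measure E} (h2 : secondMoment P < ∞) :
    Integrable (fun x => ‖x‖ ^ 2) P ∧ secondMoment P = ENNReal.ofReal (∫ x, ‖x‖ ^ 2 ∂P) := by
  simp only [secondMoment, enorm_sq_eq_ofReal] at *
  have hi : Integrable (fun x : E => ‖x‖ ^ 2) P := ⟨by fun_prop, by
    rw [hasFiniteIntegral_iff_ofReal (ae_of_all _ fun _ => sq_nonneg _)]; exact h2⟩
  exact ⟨hi, (ofReal_integral_eq_lintegral_ofReal hi (ae_of_all _ fun _ => sq_nonneg _)).symm⟩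

/-- The positive part of `-log f` is controlled by the negative part of the log-likelihood ratio and
the second moment. Non-integrability therefore comes entirely from the other part, and the entropy
is finite minus infinite. -/
theorem differentialEntropy_eq_bot {n : ℕ} {P : Measure (EuclideanSpace ℝ (Fin n))}
    [IsProbabilityMeasure P] (hP : P ≪ stdGaussian (EuclideanSpace ℝ (Fin n)))
    (h2 : secondMoment P < ∞)
    (hint : ¬ Integrable (fun x => Real.log (lebesgueDensity P x)) P) :
    differentialEntropy P = ⊥ := by
  have hV := hP.trans (stdGaussian_absolutelyContinuous_volume n)
  have hm := measurable_lebesgueDensity P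
  have hpos : ∫⁻ x, ENNReal.ofReal (-Real.log (lebesgueDensity P x)) ∂P < ∞ := by
    have hM := (secondMoment_eq_ofReal_integral h2).1
    have hM' : Integrable (fun x => ‖x‖ ^ 2 / 2 + n / 2 * Real.log (2 * Real.pi)) P := by
      fun_prop
    have hL := measurable_llr P (stdGaussian (EuclideanSpace ℝ (Fin n)))
    calc _ ≤ ∫⁻ x, (ENNReal.ofReal (-llr P (stdGaussian (EuclideanSpace ℝ (Fin n))) x) +
            ENNReal.ofReal (‖x‖ ^ 2 / 2 + n / 2 * Real.log (2 * Real.pi))) ∂P := by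
          refine lintegral_mono_ae ?_
          filter_upwards [llr_stdGaussian hP] with x hx
          refine le_trans (ENNReal.ofReal_le_ofReal (le_of_eq ?_)) ENNReal.ofReal_add_le
          rw [hx]
          ring
      _ < ∞ := by
          rw [lintegral_add_left (by fun_prop)]
          exact ENNReal.add_lt_top.2
            ⟨(lintegral_neg_llr_le_one hP).trans_lt ENNReal.one_lt_top, hM'.lintegral_lt_top⟩
  rw [differentialEntropy_eq_lintegral hV]
  have htop : ∫⁻ x, ENNReal.ofReal (Real.log (lebesgueDensity P x)) ∂P = ∞ := by
    by_contra hne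
    refine hint ⟨hm.log.aestronglyMeasurable, ?_⟩
    rw [HasFiniteIntegral]
    have habs : ∀ x, ‖Real.log (lebesgueDensity P x)‖ₑ ≤
        ENNReal.ofReal (Real.log (lebesgueDensity P x)) +
          ENNReal.ofReal (-Real.log (lebesgueDensity P x)) := fun x => by
      rw [Real.enorm_eq_ofReal_abs]
      rcases abs_cases (Real.log (lebesgueDensity P x)) with ⟨h, _⟩ | ⟨h, _⟩ <;> rw [h] <;> simp
    refine (lintegral_mono habs).trans_lt ?_
    rw [lintegral_add_left (by fun_prop)]
    exact ENNReal.add_lt_top.2 ⟨lt_top_iff_ne_top.2 hne, hpos⟩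
  rw [htop, ← EReal.coe_ennreal_toReal hpos.ne]
  simp

/-- Affine change of variables for Lebesgue densities. -/
theorem log_lebesgueDensity_map_affine {n : ℕ} {P : Measure (EuclideanSpace ℝ (Fin n))}
    [IsProbabilityMeasure P] (hP : P ≪ volume) {a : ℝ} (ha : 0 < a)
    (m : EuclideanSpace ℝ (Fin n)) :
    ∀ᵐ x ∂P, Real.log (lebesgueDensity (P.map fun x => m + a • x) (m + a • x)) =
      Real.log (lebesgueDensity P x) - n * Real.log a := by
  have hemb : MeasurableEmbedding fun x : EuclideanSpace ℝ (Fin n) => m + a • x :=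
    (measurableEmbedding_addLeft m).comp (measurableEmbedding_const_smul₀ ha.ne')
  have hprob : IsProbabilityMeasure (P.map fun x => m + a • x) :=
    Measure.isProbabilityMeasure_map hemb.measurable.aemeasurable
  -- The Jacobian: the affine map pushes Lebesgue measure to `a ^ (-n)` times itself.
  set r : ℝ≥0∞ := ENNReal.ofReal (a ^ n)⁻¹ with hr
  have hr0 : r ≠ 0 := by simp [hr]; positivity
  have hvol : (volume : Measure (EuclideanSpace ℝ (Fin n))).map (fun x => m + a • x) =
      r • volume := by
    have h1 := Measure.map_addHaar_smul (volume : Measure (EuclideanSpace ℝ (Fin n))) ha.ne'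
    rw [finrank_euclideanSpace_fin, abs_of_pos (by positivity)] at h1
    have h3 := (measurePreserving_add_left (volume : Measure (EuclideanSpace ℝ (Fin n))) m).map_eq
    rw [show (fun x : EuclideanSpace ℝ (Fin n) => m + a • x) = (fun x => m + x) ∘ fun x => a • x
      from rfl, ← Measure.map_map (by fun_prop) (by fun_prop)]
    erw [h1]
    rw [Measure.map_smul, h3]
  have h1 := hemb.rnDeriv_map P volume
  rw [hvol] at h1
  have h2 : ∀ᵐ x ∂P, (P.map fun x => m + a • x).rnDeriv (r • volume) (m + a • x) =
      r⁻¹ * (P.map fun x => m + a • x).rnDeriv volume (m + a • x) := by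
    have h := Measure.rnDeriv_smul_right_of_ne_top' (P.map fun x => m + a • x)
      (volume : Measure (EuclideanSpace ℝ (Fin n))) hr0 ENNReal.ofReal_ne_top
    have hac : (P.map fun x => m + a • x) ≪ volume := by
      refine (hP.map hemb.measurable).trans ?_
      rw [hvol]
      exact Measure.smul_absolutelyContinuous
    exact ae_of_ae_map hemb.measurable.aemeasurable (hac.ae_le h)
  filter_upwards [hP.ae_le h1, h2, lebesgueDensity_pos hP] with x h1 h2 h3
  rw [h2] at h1
  have h4 := congrArg ENNReal.toReal h1
  rw [ENNReal.toReal_mul, ENNReal.toReal_inv, hr, ENNReal.toReal_ofReal (by positivity),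
    inv_inv] at h4
  change _ * lebesgueDensity (P.map fun x => m + a • x) (m + a • x) = lebesgueDensity P x at h4
  rw [← h4] at h3 ⊢
  have h5 := pos_of_mul_pos_right h3 (by positivity)
  rw [Real.log_mul (by positivity) h5.ne', Real.log_pow]
  ring

/-! ### Wasserstein distance and integrals under couplings -/

theorem two_mul_ofReal (r : ℝ) : 2 * ENNReal.ofReal r = ENNReal.ofReal (2 * r) := by
  simp [ENNReal.ofReal_mul]

theorem wassersteinDist_two_sq_le {E : Type*} [NormedAddCommGroup E] [MeasurableSpace E]
    {μ ν : Measure E} {π : Measure (E × E)} (hπ : π ∈ couplings μ ν) :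
    wassersteinDist 2 μ ν ^ 2 ≤ ∫⁻ z, ‖z.1 - z.2‖ₑ ^ 2 ∂π := by
  have h : wassersteinDist 2 μ ν ≤ (∫⁻ z, ‖z.1 - z.2‖ₑ ^ 2 ∂π) ^ (1 / 2 : ℝ) := by
    refine (iInf₂_le π hπ).trans (le_of_eq ?_)
    simp only [edist_eq_enorm_sub, ENNReal.rpow_ofNat]
  calc _ ≤ ((∫⁻ z, ‖z.1 - z.2‖ₑ ^ 2 ∂π) ^ (1 / 2 : ℝ)) ^ 2 := by gcongr
    _ = _ := by
      rw [← ENNReal.rpow_natCast, ← ENNReal.rpow_mul]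
      norm_num

theorem le_wassersteinDist_two_sq {E : Type*} [NormedAddCommGroup E] [MeasurableSpace E]
    {μ ν : Measure E} {c : ℝ≥0∞}
    (h : ∀ π ∈ couplings μ ν, c ≤ ∫⁻ z, ‖z.1 - z.2‖ₑ ^ 2 ∂π) :
    c ≤ wassersteinDist 2 μ ν ^ 2 := by
  have h1 : c ^ (1 / 2 : ℝ) ≤ wassersteinDist 2 μ ν := by
    refine le_iInf₂ fun π hπ => ?_
    simp only [edist_eq_enorm_sub, ENNReal.rpow_ofNat]
    exact ENNReal.rpow_le_rpow (h π hπ) (by norm_num)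
  calc c = (c ^ (1 / 2 : ℝ)) ^ 2 := by
        rw [← ENNReal.rpow_natCast, ← ENNReal.rpow_mul]
        norm_num
    _ ≤ _ := by gcongr

section Coupling

variable {E : Type*} [MeasurableSpace E] {μ ν : Measure E} {π : Measure (E × E)}

theorem integral_comp_fst_of_mem_couplings (hπ : π ∈ couplings μ ν) {f : E → ℝ}
    (hf : Measurable f) : ∫ z, f z.1 ∂π = ∫ x, f x ∂μ := by
  rw [← hπ.2.1, Measure.fst, integral_map measurable_fst.aemeasurable hf.aestronglyMeasurable]

theorem integral_comp_snd_of_mem_couplings (hπ : π ∈ couplings μ ν) {f : E → ℝ}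
    (hf : Measurable f) : ∫ z, f z.2 ∂π = ∫ x, f x ∂ν := by
  rw [← hπ.2.2, Measure.snd, integral_map measurable_snd.aemeasurable hf.aestronglyMeasurable]

variable [NormedAddCommGroup E]

theorem memLp_fst_of_mem_couplings (hπ : π ∈ couplings μ ν) (h : MemLp id 2 μ) :
    MemLp Prod.fst 2 π := by
  rw [← hπ.2.1] at h
  exact h.comp_of_map measurable_fst.aemeasurable

theorem memLp_snd_of_mem_couplings (hπ : π ∈ couplings μ ν) (h : MemLp id 2 ν) :
    MemLp Prod.snd 2 π := by
  rw [← hπ.2.2] at h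
  exact h.comp_of_map measurable_snd.aemeasurable

theorem lintegral_cost_eq_ofReal (hπ : π ∈ couplings μ ν) (h1 : MemLp id 2 μ)
    (h2 : MemLp id 2 ν) : ∫⁻ z, ‖z.1 - z.2‖ₑ ^ 2 ∂π =
      ENNReal.ofReal (∫ z, ‖z.1 - z.2‖ ^ 2 ∂π) := by
  have h : MemLp (fun z : E × E => z.1 - z.2) 2 π :=
    (memLp_fst_of_mem_couplings hπ h1).sub (memLp_snd_of_mem_couplings hπ h2)
  rw [ofReal_integral_eq_lintegral_ofReal ((memLp_two_iff_integrable_sq_norm h.1).1 h)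
    (ae_of_all _ fun _ => sq_nonneg _)]
  simp only [enorm_sq_eq_ofReal]

variable [BorelSpace E] [SecondCountableTopology E]

theorem memLp_two_id_of_secondMoment (h : secondMoment μ < ∞) : MemLp id 2 μ := by
  rw [memLp_two_iff_integrable_sq_norm (by fun_prop)]
  exact (secondMoment_eq_ofReal_integral h).1

end Coupling

/-! ### Talagrand's inequality on Euclidean space and its dilations -/

section StdGaussian

variable {n : ℕ}

theorem memLp_two_id_stdGaussian : MemLp id 2 (stdGaussian (EuclideanSpace ℝ (Fin n))) :=
  IsGaussian.memLp_two_id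

theorem integral_norm_sq_stdGaussian :
    ∫ x, ‖x‖ ^ 2 ∂(stdGaussian (EuclideanSpace ℝ (Fin n))) = n := by
  rw [← map_pi_eq_stdGaussian, integral_map (by fun_prop) (by fun_prop)]
  simp only [EuclideanSpace.real_norm_sq_eq]
  have hi : Integrable (fun y : ℝ => y ^ 2) (gaussianReal 0 1) :=
    (memLp_id_gaussianReal (μ := 0) (v := 1) 2).integrable_sq
  rw [integral_finsetSum _ fun i _ => integrable_comp_eval
    (μ := fun _ : Fin n => gaussianReal 0 1) (i := i) (f := fun y : ℝ => y ^ 2) hi]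
  have : ∀ i : Fin n, ∫ x : Fin n → ℝ, x i ^ 2 ∂(Measure.pi fun _ => gaussianReal 0 1) = 1 :=
    fun i => by
      have h := integral_comp_eval (μ := fun _ : Fin n => gaussianReal 0 1) (i := i)
        (f := fun y : ℝ => y ^ 2) (by fun_prop)
      exact h.trans integral_sq_gaussianReal
  simp [this]

theorem integral_inner_stdGaussian (m : EuclideanSpace ℝ (Fin n)) :
    ∫ x, inner ℝ m x ∂(stdGaussian (EuclideanSpace ℝ (Fin n))) = 0 := by
  rw [integral_inner IsGaussian.integrable_fun_id]
  simp

/-- **Talagrand's transportation inequality** for the standard Gaussian measure on `ℝⁿ`. -/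
theorem exists_coupling_stdGaussian {P : Measure (EuclideanSpace ℝ (Fin n))}
    [IsProbabilityMeasure P] (hP : P ≪ stdGaussian (EuclideanSpace ℝ (Fin n)))
    (h2 : secondMoment P < ∞) :
    ∃ π ∈ couplings P (stdGaussian (EuclideanSpace ℝ (Fin n))),
      ∫⁻ z, ‖z.1 - z.2‖ₑ ^ 2 ∂π ≤ 2 * klDiv P (stdGaussian (EuclideanSpace ℝ (Fin n))) := by
  let e : EuclideanSpace ℝ (Fin n) ≃ᵐ (Fin n → ℝ) :=
    (MeasurableEquiv.toLp 2 (Fin n → ℝ)).symm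
  have hγ : (stdGaussian (EuclideanSpace ℝ (Fin n))).map e =
      Measure.pi fun _ => gaussianReal 0 1 := by
    rw [← map_pi_eq_stdGaussian]
    exact MeasurableEquiv.map_symm_map (MeasurableEquiv.toLp 2 (Fin n → ℝ))
  have : IsProbabilityMeasure (P.map e) :=
    Measure.isProbabilityMeasure_map e.measurable.aemeasurable
  obtain ⟨ρ, ⟨hρ, hρ1, hρ2⟩, hcost⟩ := exists_coupling_pi_gaussianReal n (P.map e)
    (by rw [← hγ]; exact hP.map e.measurable) fun i => by
      rw [lintegral_map (by fun_prop) e.measurable]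
      refine ((lintegral_mono fun x => ?_).trans_lt h2).ne
      rw [enorm_sq_eq_ofReal, EuclideanSpace.real_norm_sq_eq]
      exact ENNReal.ofReal_le_ofReal
        (Finset.single_le_sum (f := fun i => x i ^ 2) (fun j _ => sq_nonneg _) (Finset.mem_univ i))
  have hem : Measurable (Prod.map e.symm e.symm) := by fun_prop
  refine ⟨ρ.map (Prod.map e.symm e.symm), ⟨Measure.isProbabilityMeasure_map hem.aemeasurable,
    ?_, ?_⟩, ?_⟩
  · rw [Measure.fst, Measure.map_map measurable_fst hem]
    change ρ.map (e.symm ∘ Prod.fst) = P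
    rw [← Measure.map_map e.symm.measurable measurable_fst, ← Measure.fst, hρ1,
      MeasurableEquiv.map_symm_map]
  · rw [Measure.snd, Measure.map_map measurable_snd hem]
    change ρ.map (e.symm ∘ Prod.snd) = _
    rw [← Measure.map_map e.symm.measurable measurable_snd, ← Measure.snd, hρ2, ← hγ,
      MeasurableEquiv.map_symm_map]
  · rw [lintegral_map (by fun_prop) hem]
    refine le_trans (le_of_eq (lintegral_congr fun z => ?_)) (hcost.trans (mul_le_mul_right ?_ 2))
    · rw [enorm_sq_eq_ofReal, EuclideanSpace.real_norm_sq_eq,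
        ENNReal.ofReal_sum_of_nonneg fun i _ => sq_nonneg _]
      rfl
    · rw [← hγ]
      exact klDiv_map_le _ _ e.measurable

theorem integral_llr_stdGaussian {P : Measure (EuclideanSpace ℝ (Fin n))}
    [IsProbabilityMeasure P] (hP : P ≪ stdGaussian (EuclideanSpace ℝ (Fin n)))
    (h2 : MemLp id 2 P) (hint : Integrable (fun x => Real.log (lebesgueDensity P x)) P) :
    Integrable (llr P (stdGaussian (EuclideanSpace ℝ (Fin n)))) P ∧
      ∫ x, llr P (stdGaussian (EuclideanSpace ℝ (Fin n))) x ∂P =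
        ∫ x, Real.log (lebesgueDensity P x) ∂P + (∫ x, ‖x‖ ^ 2 ∂P) / 2 +
          n / 2 * Real.log (2 * Real.pi) := by
  have hM : Integrable (fun x => ‖x‖ ^ 2) P := (memLp_two_iff_integrable_sq_norm h2.1).1 h2
  refine ⟨Integrable.congr (f := fun x => Real.log (lebesgueDensity P x) + ‖x‖ ^ 2 / 2 +
    n / 2 * Real.log (2 * Real.pi)) (by fun_prop) ?_, ?_⟩
  · filter_upwards [llr_stdGaussian hP] with x hx using hx.symm
  · rw [integral_congr_ae (llr_stdGaussian hP), integral_add (by fun_prop) (by fun_prop),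
      integral_add hint (by fun_prop), integral_div]
    simp

theorem klDiv_stdGaussian {P : Measure (EuclideanSpace ℝ (Fin n))}
    [IsProbabilityMeasure P] (hP : P ≪ stdGaussian (EuclideanSpace ℝ (Fin n)))
    (h2 : MemLp id 2 P) (hint : Integrable (fun x => Real.log (lebesgueDensity P x)) P) :
    0 ≤ ∫ x, Real.log (lebesgueDensity P x) ∂P + (∫ x, ‖x‖ ^ 2 ∂P) / 2 +
          n / 2 * Real.log (2 * Real.pi) ∧
      klDiv P (stdGaussian (EuclideanSpace ℝ (Fin n))) =
        ENNReal.ofReal (∫ x, Real.log (lebesgueDensity P x) ∂P + (∫ x, ‖x‖ ^ 2 ∂P) / 2 +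
          n / 2 * Real.log (2 * Real.pi)) := by
  obtain ⟨h3, h4⟩ := integral_llr_stdGaussian hP h2 hint
  have h5 := integral_llr_add_sub_measure_univ_nonneg hP h3
  have h6 := klDiv_of_ac_of_integrable hP h3
  simp only [probReal_univ, add_sub_cancel_right, h4] at h5 h6
  exact ⟨h5, h6⟩

theorem klDiv_stdGaussian_eq_top {P : Measure (EuclideanSpace ℝ (Fin n))}
    [IsProbabilityMeasure P] (hP : P ≪ stdGaussian (EuclideanSpace ℝ (Fin n)))
    (h2 : MemLp id 2 P) (hint : ¬ Integrable (fun x => Real.log (lebesgueDensity P x)) P) :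
    klDiv P (stdGaussian (EuclideanSpace ℝ (Fin n))) = ∞ := by
  refine klDiv_of_not_integrable fun h => hint ?_
  have hM : Integrable (fun x => ‖x‖ ^ 2) P := (memLp_two_iff_integrable_sq_norm h2.1).1 h2
  refine Integrable.congr (f := fun x => llr P (stdGaussian (EuclideanSpace ℝ (Fin n))) x -
    ‖x‖ ^ 2 / 2 - n / 2 * Real.log (2 * Real.pi)) (by fun_prop) ?_
  filter_upwards [llr_stdGaussian hP] with x hx
  rw [hx]
  ring

/-- The affine image of a measure: absolute continuity, and integral of the log-density. -/
theorem integral_log_lebesgueDensity_map_affine {P : Measure (EuclideanSpace ℝ (Fin n))}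
    [IsProbabilityMeasure P] (hP : P ≪ volume)
    (hint : Integrable (fun x => Real.log (lebesgueDensity P x)) P) {a : ℝ} (ha : 0 < a)
    (m : EuclideanSpace ℝ (Fin n)) :
    Integrable (fun x => Real.log (lebesgueDensity (P.map fun x => m + a • x) x))
      (P.map fun x => m + a • x) ∧
    ∫ x, Real.log (lebesgueDensity (P.map fun x => m + a • x) x) ∂(P.map fun x => m + a • x) =
      ∫ x, Real.log (lebesgueDensity P x) ∂P - n * Real.log a := by
  have hm : Measurable fun x : EuclideanSpace ℝ (Fin n) => m + a • x := by fun_prop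
  have hd := (measurable_lebesgueDensity (P.map fun x => m + a • x)).log.aestronglyMeasurable
    (μ := P.map fun x => m + a • x)
  constructor
  · rw [integrable_map_measure hd hm.aemeasurable]
    refine Integrable.congr (hint.sub (integrable_const (n * Real.log a))) ?_
    filter_upwards [log_lebesgueDensity_map_affine hP ha m] with x hx using hx.symm
  · rw [integral_map hm.aemeasurable hd, integral_congr_ae (log_lebesgueDensity_map_affine hP ha m),
      integral_sub hint (integrable_const _)]
    simp

theorem map_affine_absolutelyContinuous_volume {P : Measure (EuclideanSpace ℝ (Fin n))}
    (hP : P ≪ volume) {a : ℝ} (ha : a ≠ 0) (m : EuclideanSpace ℝ (Fin n)) :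
    (P.map fun x => m + a • x) ≪ volume := by
  have h1 : (P.map fun x => a • x) ≪ volume := by
    refine (hP.map (by fun_prop)).trans ?_
    have h := Measure.map_addHaar_smul (volume : Measure (EuclideanSpace ℝ (Fin n))) ha
    erw [h]
    exact Measure.smul_absolutelyContinuous
  have h2 := h1.map (measurable_const_add m)
  rw [Measure.map_map (by fun_prop) (by fun_prop),
    (measurePreserving_add_left (volume : Measure (EuclideanSpace ℝ (Fin n))) m).map_eq] at h2
  exact h2

/-- The Gaussian density vanishes nowhere. Hence dilated and translated laws stay absolutely
continuous with respect to the Gaussian, and Talagrand's inequality applies to them. -/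
theorem volume_absolutelyContinuous_stdGaussian :
    volume ≪ stdGaussian (EuclideanSpace ℝ (Fin n)) := by
  rw [stdGaussian_eq_withDensity]
  exact withDensity_absolutelyContinuous' (by fun_prop)
    (ae_of_all _ fun x => (ENNReal.ofReal_pos.2 (Real.exp_pos _)).ne')

/-- Talagrand's inequality applied to the law of `a Z`, read as a bound on couplings of `Z`. -/
theorem exists_coupling_of_scaling {P : Measure (EuclideanSpace ℝ (Fin n))}
    [IsProbabilityMeasure P] (hP : P ≪ stdGaussian (EuclideanSpace ℝ (Fin n)))
    (h2 : MemLp id 2 P) (hint : Integrable (fun x => Real.log (lebesgueDensity P x)) P)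
    {a : ℝ} (ha : 0 < a) :
    ∃ π ∈ couplings P (stdGaussian (EuclideanSpace ℝ (Fin n))),
      ∫ z, ‖z.1 - z.2‖ ^ 2 ∂π ≤ ∫ x, ‖x‖ ^ 2 ∂P + n +
        (2 * ∫ x, Real.log (lebesgueDensity P x) ∂P - 2 * n * Real.log a
          + n * Real.log (2 * Real.pi) - n) / a := by
  have hV := hP.trans (stdGaussian_absolutelyContinuous_volume n)
  obtain ⟨hint', hH⟩ := integral_log_lebesgueDensity_map_affine hV hint ha 0
  have hac := (map_affine_absolutelyContinuous_volume hV ha.ne' 0).trans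
    volume_absolutelyContinuous_stdGaussian
  have hmeas : Measurable fun x : EuclideanSpace ℝ (Fin n) =>
    (0 : EuclideanSpace ℝ (Fin n)) + a • x := by fun_prop
  set Q := P.map fun x => (0 : EuclideanSpace ℝ (Fin n)) + a • x with hQ
  have : IsProbabilityMeasure Q := Measure.isProbabilityMeasure_map hmeas.aemeasurable
  have hM : Integrable (fun x => ‖x‖ ^ 2) P := (memLp_two_iff_integrable_sq_norm h2.1).1 h2
  have hQ2 : MemLp id 2 Q := by
    rw [hQ, memLp_map_measure_iff (by fun_prop) hmeas.aemeasurable]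
    have h := h2.const_smul a
    simp only [Function.comp_def, id_eq, zero_add]
    exact h
  have hQM : ∫ x, ‖x‖ ^ 2 ∂Q = a ^ 2 * ∫ x, ‖x‖ ^ 2 ∂P := by
    rw [hQ, integral_map hmeas.aemeasurable (by fun_prop), ← integral_const_mul]
    simp [norm_smul, mul_pow]
  have hQs : secondMoment Q < ∞ := by
    have hi : Integrable (fun x => ‖x‖ ^ 2) Q := (memLp_two_iff_integrable_sq_norm hQ2.1).1 hQ2
    simp only [secondMoment, enorm_sq_eq_ofReal]
    exact hi.lintegral_lt_top
  obtain ⟨π, hπ, hcost⟩ := exists_coupling_stdGaussian hac hQs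
  obtain ⟨hnn, hkl⟩ := klDiv_stdGaussian hac hQ2 hint'
  rw [lintegral_cost_eq_ofReal hπ hQ2 memLp_two_id_stdGaussian, hkl,
    two_mul_ofReal, ENNReal.ofReal_le_ofReal_iff (by positivity), hH, hQM] at hcost
  have hm' : Measurable fun z : EuclideanSpace ℝ (Fin n) × EuclideanSpace ℝ (Fin n) =>
    (a⁻¹ • z.1, z.2) := by fun_prop
  have hf := memLp_fst_of_mem_couplings hπ hQ2
  have hs := memLp_snd_of_mem_couplings hπ memLp_two_id_stdGaussian
  have hf2 := (memLp_two_iff_integrable_sq_norm hf.1).1 hf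
  have hs2 := (memLp_two_iff_integrable_sq_norm hs.1).1 hs
  have hd2 : Integrable (fun z => ‖z.1 - z.2‖ ^ 2) π :=
    (memLp_two_iff_integrable_sq_norm (hf.sub hs).1).1 (hf.sub hs)
  -- Undo the dilation in the first coordinate of the coupling found for `aZ`.
  refine ⟨π.map fun z => (a⁻¹ • z.1, z.2), ⟨?_, ?_, ?_⟩, ?_⟩
  · have := hπ.1
    exact Measure.isProbabilityMeasure_map hm'.aemeasurable
  · rw [Measure.fst, Measure.map_map measurable_fst hm']
    change π.map ((fun x => a⁻¹ • x) ∘ Prod.fst) = P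
    rw [← Measure.map_map (by fun_prop) measurable_fst, ← Measure.fst, hπ.2.1, hQ,
      Measure.map_map (by fun_prop) hmeas]
    convert Measure.map_id
    ext1 x
    simp [smul_smul, ha.ne']
  · rw [Measure.snd, Measure.map_map measurable_snd hm']
    exact hπ.2.2
  · rw [integral_map hm'.aemeasurable (by fun_prop)]
    -- Polarization trades the cross term of the new cost for the old cost divided by `a`; the
    -- remaining terms depend on the marginals only.
    have hpt : ∀ z : EuclideanSpace ℝ (Fin n) × EuclideanSpace ℝ (Fin n),
        ‖a⁻¹ • z.1 - z.2‖ ^ 2 = ‖z.1‖ ^ 2 * (a⁻¹ ^ 2 - a⁻¹) + ‖z.2‖ ^ 2 * (1 - a⁻¹) +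
          ‖z.1 - z.2‖ ^ 2 * a⁻¹ := fun z => by
      rw [norm_sub_sq_real, norm_sub_sq_real, norm_smul, real_inner_smul_left, mul_pow,
        Real.norm_eq_abs, sq_abs]
      ring
    simp only [hpt]
    rw [integral_add (by fun_prop) (by fun_prop), integral_add (by fun_prop) (by fun_prop),
      integral_mul_const, integral_mul_const,
      integral_mul_const,
      integral_comp_fst_of_mem_couplings hπ (f := fun x => ‖x‖ ^ 2) (by fun_prop),
      integral_comp_snd_of_mem_couplings hπ (f := fun x => ‖x‖ ^ 2) (by fun_prop),
      integral_norm_sq_stdGaussian, hQM]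
    have h := mul_le_mul_of_nonneg_right hcost (inv_nonneg.2 ha.le)
    have h1 : a ^ 2 * a⁻¹ ^ 2 = 1 := by field_simp
    have h3 : a * a⁻¹ = 1 := by field_simp
    set M := ∫ x, ‖x‖ ^ 2 ∂P
    rw [div_eq_mul_inv]
    have e1 : a ^ 2 * M * (a⁻¹ ^ 2 - a⁻¹) = M - a ^ 2 * M * a⁻¹ := by
      linear_combination M * h1
    rw [e1]
    linarith

end StdGaussian

/-! ### The entropic bound and its comparison with Talagrand's -/

section TransportBound

variable {n : ℕ}

theorem transportBound_of_entropy_eq_bot (hn : 0 < n) {P : Measure (EuclideanSpace ℝ (Fin n))}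
    {M : ℝ} (hM0 : 0 ≤ M) (hM : secondMoment P = ENNReal.ofReal M)
    (h : differentialEntropy P = ⊥) : transportBound P = ((M + n : ℝ) : EReal) := by
  have hpos : (0 : ℝ) < 2 / n := by positivity
  rw [transportBound, h, EReal.coe_mul_bot_of_pos hpos, hM, EReal.coe_ennreal_ofReal,
    max_eq_left hM0]
  simp

theorem transportBound_of_entropy_eq_coe (hn : 0 < n) {P : Measure (EuclideanSpace ℝ (Fin n))}
    {M h : ℝ} (hM0 : 0 ≤ M) (hM : secondMoment P = ENNReal.ofReal M)
    (hh : differentialEntropy P = (h : EReal)) :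
    transportBound P =
      ((M + n - 2 * n * Real.exp (h / n - 1 / 2 - Real.log (2 * Real.pi) / 2) : ℝ) : EReal) := by
  have hn' : (n : ℝ) ≠ 0 := by positivity
  have h1 : (ENNReal.ofReal (1 / (2 * Real.pi * Real.exp 1)) *
      EReal.exp (((2 / n : ℝ) : EReal) * (h : EReal))) ^ (1 / 2 : ℝ) =
      ENNReal.ofReal (Real.exp (h / n - 1 / 2 - Real.log (2 * Real.pi) / 2)) := by
    rw [← EReal.coe_mul, EReal.exp_coe, ← ENNReal.ofReal_mul (by positivity),
      ENNReal.ofReal_rpow_of_nonneg (by positivity) (by norm_num)]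
    congr 1
    have h2 : 1 / (2 * Real.pi * Real.exp 1) = Real.exp (-Real.log (2 * Real.pi) - 1) := by
      rw [Real.exp_sub, Real.exp_neg, Real.exp_log (by positivity)]
      field_simp
    rw [h2, ← Real.exp_add, ← Real.exp_mul]
    congr 1
    field_simp
    ring
  rw [transportBound, hh, h1, hM, EReal.coe_ennreal_ofReal, EReal.coe_ennreal_ofReal,
    max_eq_left hM0, max_eq_left (Real.exp_pos _).le]
  norm_cast

theorem coe_two_mul_klDiv_stdGaussian {P : Measure (EuclideanSpace ℝ (Fin n))}
    [IsProbabilityMeasure P] (hP : P ≪ stdGaussian (EuclideanSpace ℝ (Fin n)))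
    (h2 : MemLp id 2 P) (hint : Integrable (fun x => Real.log (lebesgueDensity P x)) P) :
    ((2 * klDiv P (stdGaussian (EuclideanSpace ℝ (Fin n))) : ℝ≥0∞) : EReal) =
      ((2 * (∫ x, Real.log (lebesgueDensity P x) ∂P) + ∫ x, ‖x‖ ^ 2 ∂P +
        n * Real.log (2 * Real.pi) : ℝ) : EReal) := by
  obtain ⟨h3, h4⟩ := klDiv_stdGaussian hP h2 hint
  rw [h4, two_mul_ofReal, EReal.coe_ennreal_ofReal, max_eq_left (by linarith)]
  congr 1
  ring

theorem wassersteinDist_two_sq_le_coe {P : Measure (EuclideanSpace ℝ (Fin n))}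
    (h2 : MemLp id 2 P) {π : Measure (EuclideanSpace ℝ (Fin n) × EuclideanSpace ℝ (Fin n))}
    (hπ : π ∈ couplings P (stdGaussian (EuclideanSpace ℝ (Fin n)))) {r : ℝ}
    (hr : ∫ z, ‖z.1 - z.2‖ ^ 2 ∂π ≤ r) :
    ((wassersteinDist 2 P (stdGaussian (EuclideanSpace ℝ (Fin n))) ^ 2 : ℝ≥0∞) : EReal) ≤
      (r : EReal) := by
  have h := wassersteinDist_two_sq_le hπ
  rw [lintegral_cost_eq_ofReal hπ h2 memLp_two_id_stdGaussian] at h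
  refine (EReal.coe_ennreal_le_coe_ennreal_iff.2 h).trans ?_
  rw [EReal.coe_ennreal_ofReal, max_eq_left (integral_nonneg fun _ => sq_nonneg _)]
  exact EReal.coe_le_coe_iff.2 hr

/-- Under the independent coupling the cross term vanishes because the Gaussian is centred. This
cost is the bound `B` when the entropy is `-∞`. -/
theorem integral_cost_prod_stdGaussian {P : Measure (EuclideanSpace ℝ (Fin n))}
    [IsProbabilityMeasure P] (h2 : MemLp id 2 P) :
    ∫ z, ‖z.1 - z.2‖ ^ 2 ∂(P.prod (stdGaussian (EuclideanSpace ℝ (Fin n)))) =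
      ∫ x, ‖x‖ ^ 2 ∂P + n := by
  have hπ : P.prod (stdGaussian (EuclideanSpace ℝ (Fin n))) ∈
      couplings P (stdGaussian (EuclideanSpace ℝ (Fin n))) :=
    ⟨inferInstance, by simp, by simp⟩
  have hf := memLp_fst_of_mem_couplings hπ h2
  have hs := memLp_snd_of_mem_couplings hπ memLp_two_id_stdGaussian
  have hf2 := (memLp_two_iff_integrable_sq_norm hf.1).1 hf
  have hs2 := (memLp_two_iff_integrable_sq_norm hs.1).1 hs
  have hd2 := (memLp_two_iff_integrable_sq_norm (hf.sub hs).1).1 (hf.sub hs)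
  have hi : Integrable (fun z : EuclideanSpace ℝ (Fin n) × EuclideanSpace ℝ (Fin n) =>
      inner ℝ z.1 z.2) (P.prod (stdGaussian (EuclideanSpace ℝ (Fin n)))) := by
    have hall := ((hf2.add hs2).sub hd2).div_const 2
    refine hall.congr (ae_of_all _ fun z => ?_)
    simp only [Pi.sub_apply, Pi.add_apply, norm_sub_sq_real]
    ring
  have h0 : ∫ z : EuclideanSpace ℝ (Fin n) × EuclideanSpace ℝ (Fin n), inner ℝ z.1 z.2
      ∂(P.prod (stdGaussian (EuclideanSpace ℝ (Fin n)))) = 0 := by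
    rw [integral_prod _ hi]
    simp [integral_inner_stdGaussian]
  simp only [norm_sub_sq_real]
  rw [integral_add (by fun_prop) hs2, integral_sub hf2 (by fun_prop), integral_const_mul, h0,
    integral_comp_fst_of_mem_couplings hπ (f := fun x => ‖x‖ ^ 2) (by fun_prop),
    integral_comp_snd_of_mem_couplings hπ (f := fun x => ‖x‖ ^ 2) (by fun_prop),
    integral_norm_sq_stdGaussian]
  simp

/-- The transportation inequality. -/
theorem wassersteinDist_sq_le_transportBound (hn : 0 < n)
    {P : Measure (EuclideanSpace ℝ (Fin n))} [IsProbabilityMeasure P]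
    (hP : P ≪ stdGaussian (EuclideanSpace ℝ (Fin n))) (hs : secondMoment P < ∞) :
    ((wassersteinDist 2 P (stdGaussian (EuclideanSpace ℝ (Fin n))) ^ 2 : ℝ≥0∞) : EReal) ≤
      transportBound P := by
  have h2 := memLp_two_id_of_secondMoment hs
  have hM := (secondMoment_eq_ofReal_integral hs).2
  have hM0 : 0 ≤ ∫ x, ‖x‖ ^ 2 ∂P := integral_nonneg fun _ => sq_nonneg _
  have hV := hP.trans (stdGaussian_absolutelyContinuous_volume n)
  by_cases hint : Integrable (fun x => Real.log (lebesgueDensity P x)) P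
  · rw [transportBound_of_entropy_eq_coe hn hM0 hM (differentialEntropy_eq_integral hV hint)]
    set H := ∫ x, Real.log (lebesgueDensity P x) ∂P with hH
    -- This `a` minimizes the right side: with `H = -h(Z)`, the numerator of the fraction becomes
    -- `-2n`, and `1/a` is the square root appearing in `B`.
    obtain ⟨π, hπ, hc⟩ := exists_coupling_of_scaling hP h2 hint
      (Real.exp_pos (1 / 2 + H / n + Real.log (2 * Real.pi) / 2))
    refine wassersteinDist_two_sq_le_coe h2 hπ (hc.trans (le_of_eq ?_))
    have hn' : (n : ℝ) ≠ 0 := by positivity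
    rw [Real.log_exp, div_eq_mul_inv, ← Real.exp_neg, ← hH,
      show -(1 / 2 + H / n + Real.log (2 * Real.pi) / 2) =
        -H / n - 1 / 2 - Real.log (2 * Real.pi) / 2 by ring]
    field_simp
    ring
  · rw [transportBound_of_entropy_eq_bot hn hM0 hM (differentialEntropy_eq_bot hP hs hint)]
    exact wassersteinDist_two_sq_le_coe h2 ⟨inferInstance, by simp, by simp⟩
      (integral_cost_prod_stdGaussian h2).le

/-- Comparison with Talagrand's bound. -/
theorem transportBound_le_two_mul_klDiv (hn : 0 < n)
    {P : Measure (EuclideanSpace ℝ (Fin n))} [IsProbabilityMeasure P]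
    (hP : P ≪ stdGaussian (EuclideanSpace ℝ (Fin n))) (hs : secondMoment P < ∞) :
    transportBound P ≤ ((2 * klDiv P (stdGaussian (EuclideanSpace ℝ (Fin n))) : ℝ≥0∞) : EReal) ∧
      (transportBound P = ((2 * klDiv P (stdGaussian (EuclideanSpace ℝ (Fin n))) : ℝ≥0∞) : EReal) ↔
        differentialEntropy P = ((n / 2 * Real.log (2 * Real.pi * Real.exp 1) : ℝ) : EReal)) := by
  have h2 := memLp_two_id_of_secondMoment hs
  have hM := (secondMoment_eq_ofReal_integral hs).2
  have hM0 : 0 ≤ ∫ x, ‖x‖ ^ 2 ∂P := integral_nonneg fun _ => sq_nonneg _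
  have hV := hP.trans (stdGaussian_absolutelyContinuous_volume n)
  by_cases hint : Integrable (fun x => Real.log (lebesgueDensity P x)) P
  · have hh := differentialEntropy_eq_integral hV hint
    rw [transportBound_of_entropy_eq_coe hn hM0 hM hh, coe_two_mul_klDiv_stdGaussian hP h2 hint,
      hh, EReal.coe_le_coe_iff, EReal.coe_eq_coe_iff, EReal.coe_eq_coe_iff,
      Real.log_mul (by positivity) (Real.exp_ne_zero _), Real.log_exp]
    set H := ∫ x, Real.log (lebesgueDensity P x) ∂P
    have hn' : (0 : ℝ) < n := by positivity
    -- In terms of `t`, Talagrand's bound is `E‖Z‖² - 2nt - n` and `B` is `E‖Z‖² + n - 2n exp t`, so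
    -- everything reduces to `t + 1 ≤ exp t`.
    set t := -H / n - 1 / 2 - Real.log (2 * Real.pi) / 2 with ht
    have hHt : H = -(n * (t + 1 / 2 + Real.log (2 * Real.pi) / 2)) := by
      rw [ht]; field_simp; ring
    rw [hHt]
    have hexp := mul_le_mul_of_nonneg_left (Real.add_one_le_exp t) hn'.le
    refine ⟨by linarith, fun h => ?_, fun h => ?_⟩
    · have h3 : (n : ℝ) * (t + 1) = n * Real.exp t := by linarith
      have h4 : t + 1 = Real.exp t := mul_left_cancel₀ hn'.ne' h3
      have h5 : t = 0 := by
        by_contra h0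
        exact (Real.add_one_lt_exp h0).ne h4
      rw [h5]; ring
    · have h3 : (n : ℝ) * t = 0 := by linarith
      have h5 : t = 0 := (mul_eq_zero.1 h3).resolve_left hn'.ne'
      rw [h5, Real.exp_zero]; ring
  -- Here `B` is finite, the divergence is infinite and the entropy is `-∞`, so both sides of the
  -- equivalence fail.
  · have hh := differentialEntropy_eq_bot hP hs hint
    rw [transportBound_of_entropy_eq_bot hn hM0 hM hh, hh, klDiv_stdGaussian_eq_top hP h2 hint,
      ENNReal.mul_top two_ne_zero, EReal.coe_ennreal_top]
    exact ⟨le_top, fun h => absurd h (EReal.coe_ne_top _), fun h => absurd h.symm (EReal.coe_ne_bot _)⟩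

end TransportBound

/-! ### Isotropic Gaussians -/

section Isotropic

variable {n : ℕ}

open scoped MatrixOrder in
theorem multivariateGaussian_sq_smul_one (m : EuclideanSpace ℝ (Fin n)) {σ : ℝ} (hσ : 0 < σ) :
    multivariateGaussian m (σ ^ 2 • (1 : Matrix (Fin n) (Fin n) ℝ)) =
      (stdGaussian (EuclideanSpace ℝ (Fin n))).map fun x => m + σ • x := by
  have h : CFC.sqrt (σ ^ 2 • (1 : Matrix (Fin n) (Fin n) ℝ)) = σ • 1 := by
    refine CFC.sqrt_unique ?_ ?_
    · simp [smul_smul, sq]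
    · rw [Matrix.nonneg_iff_posSemidef]
      exact Matrix.PosSemidef.one.smul hσ.le
  rw [multivariateGaussian, h]
  simp

theorem integral_log_lebesgueDensity_stdGaussian :
    Integrable (fun x => Real.log (lebesgueDensity (stdGaussian (EuclideanSpace ℝ (Fin n))) x))
      (stdGaussian (EuclideanSpace ℝ (Fin n))) ∧
    ∫ x, Real.log (lebesgueDensity (stdGaussian (EuclideanSpace ℝ (Fin n))) x)
      ∂(stdGaussian (EuclideanSpace ℝ (Fin n))) =
      -(n / 2 * Real.log (2 * Real.pi * Real.exp 1)) := by
  have hM : Integrable (fun x => ‖x‖ ^ 2) (stdGaussian (EuclideanSpace ℝ (Fin n))) :=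
    (memLp_two_iff_integrable_sq_norm memLp_two_id_stdGaussian.1).1 memLp_two_id_stdGaussian
  have h : (fun x => Real.log (lebesgueDensity (stdGaussian (EuclideanSpace ℝ (Fin n))) x))
      =ᵐ[stdGaussian (EuclideanSpace ℝ (Fin n))]
      fun x => -(‖x‖ ^ 2 / 2) - n / 2 * Real.log (2 * Real.pi) := by
    filter_upwards [(stdGaussian_absolutelyContinuous_volume n).ae_le
      (lebesgueDensity_stdGaussian n)] with x hx
    rw [hx, Real.log_exp]
  refine ⟨Integrable.congr (by fun_prop) h.symm, ?_⟩
  rw [integral_congr_ae h, integral_sub (by fun_prop) (by fun_prop), integral_neg, integral_div,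
    integral_norm_sq_stdGaussian, Real.log_mul (by positivity) (Real.exp_ne_zero _), Real.log_exp]
  simp
  ring

theorem differentialEntropy_map_affine_stdGaussian (m : EuclideanSpace ℝ (Fin n)) {σ : ℝ}
    (hσ : 0 < σ) :
    differentialEntropy ((stdGaussian (EuclideanSpace ℝ (Fin n))).map fun x => m + σ • x) =
      ((n / 2 * Real.log (2 * Real.pi * Real.exp 1) + n * Real.log σ : ℝ) : EReal) := by
  have hV := stdGaussian_absolutelyContinuous_volume n
  obtain ⟨hi, he⟩ := integral_log_lebesgueDensity_stdGaussian (n := n)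
  obtain ⟨hi', he'⟩ := integral_log_lebesgueDensity_map_affine hV hi hσ m
  have : IsProbabilityMeasure
      ((stdGaussian (EuclideanSpace ℝ (Fin n))).map fun x => m + σ • x) :=
    Measure.isProbabilityMeasure_map (by fun_prop)
  rw [differentialEntropy_eq_integral (map_affine_absolutelyContinuous_volume hV hσ.ne' m) hi',
    he', he]
  congr 1
  ring

theorem memLp_two_id_map_affine_stdGaussian (m : EuclideanSpace ℝ (Fin n)) (σ : ℝ) :
    MemLp id 2 ((stdGaussian (EuclideanSpace ℝ (Fin n))).map fun x => m + σ • x) := by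
  rw [memLp_map_measure_iff (by fun_prop) (by fun_prop)]
  exact (memLp_const m).add (memLp_two_id_stdGaussian.const_smul σ)

/-- Equality in the transportation inequality for isotropic Gaussians. -/
theorem wassersteinDist_sq_eq_transportBound (hn : 0 < n) (m : EuclideanSpace ℝ (Fin n)) {σ : ℝ}
    (hσ : 0 < σ) :
    ((wassersteinDist 2 ((stdGaussian (EuclideanSpace ℝ (Fin n))).map fun x => m + σ • x)
        (stdGaussian (EuclideanSpace ℝ (Fin n))) ^ 2 : ℝ≥0∞) : EReal) =
      transportBound ((stdGaussian (EuclideanSpace ℝ (Fin n))).map fun x => m + σ • x) := by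
  have hent := differentialEntropy_map_affine_stdGaussian m hσ
  have h2 := memLp_two_id_map_affine_stdGaussian m σ
  have hac := (map_affine_absolutelyContinuous_volume
    (stdGaussian_absolutelyContinuous_volume n) hσ.ne' m).trans
    volume_absolutelyContinuous_stdGaussian
  have hprob : IsProbabilityMeasure
      ((stdGaussian (EuclideanSpace ℝ (Fin n))).map fun x => m + σ • x) :=
    Measure.isProbabilityMeasure_map (by fun_prop)
  have hcent : ∫ x, ‖x - m‖ ^ 2
      ∂((stdGaussian (EuclideanSpace ℝ (Fin n))).map fun x => m + σ • x) = σ ^ 2 * n := by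
    rw [integral_map (by fun_prop) (by fun_prop)]
    simp [norm_smul, mul_pow, integral_const_mul, integral_norm_sq_stdGaussian]
  set P := (stdGaussian (EuclideanSpace ℝ (Fin n))).map fun x => m + σ • x
  have hs : secondMoment P < ∞ := by
    simp only [secondMoment, enorm_sq_eq_ofReal]
    exact ((memLp_two_iff_integrable_sq_norm h2.1).1 h2).lintegral_lt_top
  refine le_antisymm (wassersteinDist_sq_le_transportBound hn hac hs) ?_
  have hM := (secondMoment_eq_ofReal_integral hs).2
  have hM0 : 0 ≤ ∫ x, ‖x‖ ^ 2 ∂P := integral_nonneg fun _ => sq_nonneg _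
  have hn' : (n : ℝ) ≠ 0 := by positivity
  -- The square root in `B` is exactly the standard deviation `σ` for an isotropic Gaussian.
  have hexp : Real.exp ((n / 2 * Real.log (2 * Real.pi * Real.exp 1) + n * Real.log σ) / n - 1 / 2
      - Real.log (2 * Real.pi) / 2) = σ := by
    rw [Real.log_mul (by positivity) (Real.exp_ne_zero _), Real.log_exp]
    conv_rhs => rw [← Real.exp_log hσ]
    congr 1
    field_simp
    ring
  rw [transportBound_of_entropy_eq_coe hn hM0 hM hent, hexp]
  refine le_trans ?_ (EReal.coe_ennreal_le_coe_ennreal_iff.2 (le_wassersteinDist_two_sq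
    (c := ENNReal.ofReal (∫ x, ‖x‖ ^ 2 ∂P + n - 2 * n * σ)) fun π hπ => ?_))
  · rw [EReal.coe_ennreal_ofReal]
    exact EReal.coe_le_coe_iff.2 (le_max_left _ _)
  rw [lintegral_cost_eq_ofReal hπ h2 memLp_two_id_stdGaussian]
  refine ENNReal.ofReal_le_ofReal ?_
  have hf := memLp_fst_of_mem_couplings hπ h2
  have hg := memLp_snd_of_mem_couplings hπ memLp_two_id_stdGaussian
  have := hπ.1
  have hfm : MemLp (fun z : EuclideanSpace ℝ (Fin n) × EuclideanSpace ℝ (Fin n) => z.1 - m) 2 π :=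
    hf.sub (memLp_const m)
  have hf2 := (memLp_two_iff_integrable_sq_norm hf.1).1 hf
  have hg2 := (memLp_two_iff_integrable_sq_norm hg.1).1 hg
  have hfm2 := (memLp_two_iff_integrable_sq_norm hfm.1).1 hfm
  have hd2 : Integrable (fun z => ‖z.1 - z.2‖ ^ 2) π :=
    (memLp_two_iff_integrable_sq_norm (hf.sub hg).1).1 (hf.sub hg)
  have hin : Integrable (fun z : EuclideanSpace ℝ (Fin n) × EuclideanSpace ℝ (Fin n) =>
      inner ℝ m z.2) π := (hg.integrable (by norm_num)).const_inner m
  -- Kantorovich duality with quadratic potentials: the integrand is a function of `z.1` plus a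
  -- function of `z.2`, so its integral is the same for every coupling.
  calc ∫ x, ‖x‖ ^ 2 ∂P + n - 2 * n * σ
      = ∫ z, (‖z.1‖ ^ 2 + ‖z.2‖ ^ 2 - 2 * inner ℝ m z.2 - ‖z.1 - m‖ ^ 2 / σ - σ * ‖z.2‖ ^ 2) ∂π := by
        rw [integral_sub (by fun_prop) (by fun_prop), integral_sub (by fun_prop) (by fun_prop),
          integral_sub (by fun_prop) (by fun_prop), integral_add (by fun_prop) (by fun_prop),
          integral_const_mul, integral_const_mul, integral_div,
          integral_comp_fst_of_mem_couplings hπ (f := fun x => ‖x‖ ^ 2) (by fun_prop),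
          integral_comp_fst_of_mem_couplings hπ (f := fun x => ‖x - m‖ ^ 2) (by fun_prop),
          integral_comp_snd_of_mem_couplings hπ (f := fun x => ‖x‖ ^ 2) (by fun_prop),
          integral_comp_snd_of_mem_couplings hπ (f := fun x => inner ℝ m x) (by fun_prop),
          integral_norm_sq_stdGaussian, integral_inner_stdGaussian, hcent]
        field_simp
        ring
    _ ≤ ∫ z, ‖z.1 - z.2‖ ^ 2 ∂π := by
        refine integral_mono (by fun_prop) hd2 fun z => ?_
        -- The difference between the cost and the potentials is this square, which vanishes exactly
        -- on the graph of the affine map `y ↦ m + σ y`.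
        have h1 : 0 ≤ ‖z.1 - m - σ • z.2‖ ^ 2 / σ := by positivity
        rw [norm_sub_sq_real, real_inner_smul_right, inner_sub_left, norm_smul, mul_pow,
          Real.norm_eq_abs, sq_abs] at h1
        have h2 : (‖z.1 - m‖ ^ 2 - 2 * (σ * (inner ℝ z.1 z.2 - inner ℝ m z.2)) +
            σ ^ 2 * ‖z.2‖ ^ 2) / σ = ‖z.1 - m‖ ^ 2 / σ - 2 * (inner ℝ z.1 z.2 - inner ℝ m z.2) +
            σ * ‖z.2‖ ^ 2 := by
          field_simp
        simp only [norm_sub_sq_real z.1 z.2]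
        linarith

end Isotropic

end

theorem theoremT (n : ℕ) (hn : 0 < n) :
    (∀ P : Measure (EuclideanSpace ℝ (Fin n)), IsProbabilityMeasure P →
      P ≪ stdGaussian (EuclideanSpace ℝ (Fin n)) → secondMoment P < ⊤ →
        -- the transportation inequality
        ((wassersteinDist 2 P (stdGaussian (EuclideanSpace ℝ (Fin n))) ^ 2 : ℝ≥0∞) : EReal)
            ≤ transportBound P ∧
        -- the bound is never weaker than Talagrand's bound
        transportBound P
            ≤ ((2 * klDiv P (stdGaussian (EuclideanSpace ℝ (Fin n))) : ℝ≥0∞) : EReal) ∧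
        -- the two bounds agree exactly when `h(Z) = (n / 2) log (2 π e)`
        (transportBound P
            = ((2 * klDiv P (stdGaussian (EuclideanSpace ℝ (Fin n))) : ℝ≥0∞) : EReal) ↔
          differentialEntropy P
            = ((n / 2 * Real.log (2 * Real.pi * Real.exp 1) : ℝ) : EReal))) ∧
    -- equality in the transportation inequality for isotropic Gaussians
    (∀ (m : EuclideanSpace ℝ (Fin n)) (σ : ℝ), 0 < σ →
      ((wassersteinDist 2 (multivariateGaussian m (σ ^ 2 • (1 : Matrix (Fin n) (Fin n) ℝ)))
          (stdGaussian (EuclideanSpace ℝ (Fin n))) ^ 2 : ℝ≥0∞) : EReal)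
        = transportBound (multivariateGaussian m (σ ^ 2 • (1 : Matrix (Fin n) (Fin n) ℝ)))) ∧
    -- the entropy condition above holds for the shifted standard Gaussians
    (∀ m : EuclideanSpace ℝ (Fin n),
      differentialEntropy (multivariateGaussian m (1 : Matrix (Fin n) (Fin n) ℝ))
        = ((n / 2 * Real.log (2 * Real.pi * Real.exp 1) : ℝ) : EReal)) := by
  refine ⟨fun P _ hP hs => ⟨wassersteinDist_sq_le_transportBound hn hP hs,
    transportBound_le_two_mul_klDiv hn hP hs⟩, fun m σ hσ => ?_, fun m => ?_⟩
  · rw [multivariateGaussian_sq_smul_one m hσ]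
    exact wassersteinDist_sq_eq_transportBound hn m hσ
  · have h := differentialEntropy_map_affine_stdGaussian m one_pos
    rw [← multivariateGaussian_sq_smul_one m one_pos] at h
    simpa using h
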